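/- For an integer $d\ge 1$, let $M_d$ be the algebra of complex $d\times d$ matrices. For $1\le p<\infty$ let $\|A\|_p=(\mathrm{Tr}\,|A|^p)^{1/p}$ be the Schatten norm, and for $Y\in M_m\otimes M_n$ put $$\|Y\|_{(\infty,p)}=\sup_{0\ne A,B\in M_m}\frac{\|(A\otimes I_n)\,Y\,(B\otimes I_n)\|_p}{\|A\|_{2p}\,\|B\|_{2p}},\qquad \|Y\|_{(1,p)}=\inf_{\substack{Y=(A\otimes I_n)Z(B\otimes I_n)\\ A,B\in M_m,\ Z\in M_m\otimes M_n}}\|A\|_2\,\|B\|_2\,\|Z\|_{(\infty,p)} .$$ Let $S(Q)=-\mathrm{Tr}\,Q\log Q$ be the von Neumann entropy (natural logarithm, $0\log 0=0$), and let $\mathrm{Tr}_2$ be the partial trace over $M_n$. **Theorem.** Let $X=X_{12}\in M_m\otimes M_n$ satisfy $X\ge 0$ and $\mathrm{Tr}\,X=1$, and let $X_1=\mathrm{Tr}_2X$. Then the function $p\mapsto\|X_{12}\|_{(1,p)}^p$, defined for $p\ge 1$, has a (right) derivative at $p=1$, and $$\frac{d}{dp}\,\|X_{12}\|_{(1,p)}^{\,p}\,\Big|_{p=1}=-S(X_{12})+S(X_1).$$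 -/

import Mathlib

open scoped Kronecker ComplexOrder

noncomputable section

namespace OperatorSpaceEntropy

/-- The absolute value `|A| = (A* A)^{1/2}` of a complex square matrix, through the functional
calculus (spectral decomposition) of the positive semidefinite matrix `A* A`. -/
def matAbs {ι : Type*} [Fintype ι] [DecidableEq ι] (A : Matrix ι ι ℂ) : Matrix ι ι ℂ :=
  cfc Real.sqrt (A.conjTranspose * A)

/-- The Schatten norm `‖A‖_p = (Tr |A|^p)^{1/p}` for a finite exponent `p`. -/
def schattenNorm {ι : Type*} [Fintype ι] [DecidableEq ι] (p : ℝ) (A : Matrix ι ι ℂ) : ℝ :=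
  ((cfc (fun x : ℝ => x ^ p) (matAbs A)).trace.re) ^ (1 / p)

/-- The norm of `L_∞(M_m; L_p(M_n))`:
`‖Y‖_{(∞,p)} = sup_{A, B ∈ M_m} ‖(A ⊗ I) Y (B ⊗ I)‖_p / (‖A‖_{2p} ‖B‖_{2p})`. -/
def normInfty {m n : ℕ} (p : ℝ) (Y : Matrix (Fin m × Fin n) (Fin m × Fin n) ℂ) : ℝ :=
  sSup {r : ℝ | ∃ A B : Matrix (Fin m) (Fin m) ℂ, A ≠ 0 ∧ B ≠ 0 ∧
    r = schattenNorm p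
          ((A ⊗ₖ (1 : Matrix (Fin n) (Fin n) ℂ)) * Y * (B ⊗ₖ (1 : Matrix (Fin n) (Fin n) ℂ)))
        / (schattenNorm (2 * p) A * schattenNorm (2 * p) B)}

/-- The norm of `L_t(M_m; L_p(M_n))` for finite `t`:
`‖Y‖_{(t,p)} = inf ‖A‖_{2t} ‖B‖_{2t} ‖Z‖_{(∞,p)}`, the infimum over all factorizations
`Y = (A ⊗ I) Z (B ⊗ I)` with `A, B ∈ M_m`. -/
def normLtLp {m n : ℕ} (t p : ℝ) (Y : Matrix (Fin m × Fin n) (Fin m × Fin n) ℂ) : ℝ :=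
  sInf {r : ℝ | ∃ (A B : Matrix (Fin m) (Fin m) ℂ) (Z : Matrix (Fin m × Fin n) (Fin m × Fin n) ℂ),
    Y = (A ⊗ₖ (1 : Matrix (Fin n) (Fin n) ℂ)) * Z * (B ⊗ₖ (1 : Matrix (Fin n) (Fin n) ℂ)) ∧
    r = schattenNorm (2 * t) A * schattenNorm (2 * t) B * normInfty p Z}

/-- The partial trace `X_1 = Tr_2 X` over the second tensor factor. -/
def partialTrace₂ {m n : ℕ} (X : Matrix (Fin m × Fin n) (Fin m × Fin n) ℂ) :
    Matrix (Fin m) (Fin m) ℂ :=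
  Matrix.of fun i k => ∑ j : Fin n, X (i, j) (k, j)

/-- The von Neumann entropy `S(Q) = - Tr Q log Q`, with `0 log 0 = 0` and the natural logarithm. -/
def vnEntropy {ι : Type*} [Fintype ι] [DecidableEq ι] (Q : Matrix ι ι ℂ) : ℝ :=
  -(cfc (fun x : ℝ => x * Real.log x) Q).trace.re

end OperatorSpaceEntropy

end

/-!
For `p ≥ 1` and `S` the entropy,
`exp ((p - 1) (S(X₁) - S(X))) ≤ ‖X‖_{(1,p)}^p ≤ Tr (X₁^{1-p} ⊗ I) X^p`.
Both bounds equal `1` at `p = 1` and have the derivative `S(X₁) - S(X)` there, which forces the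
same derivative on the function between them.

Lower bound, for `p > 1` with conjugate exponent `q`: given a factorization `X = (A ⊗ I) Z (B ⊗ I)`,
the function `Tr (A^{1-z} ⊗ I) Z (B^{1-z} ⊗ I) X^z` has modulus at most `1` on `re z = 0`, with
value `1` at `0`, and modulus at most `‖Z‖_{(∞,p)} (‖A‖_2 ‖B‖_2)^{1/p}` on `re z = 1/q`, by Hölder.
The three lines theorem therefore bounds its derivative at `0`, where Klein's inequality compares
the logarithms of `A A* / ‖A‖_2^2` and `B* B / ‖B‖_2^2` with that of `X₁`.

Upper bound: with `P = Tr₂ X^p`, factor `X` with `P^{1/2p} ⊗ I` on both sides. Interpolating between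
the operator norm and the trace norm shows that the middle factor has `(∞,p)`-norm at most `1`, so
`‖X‖_{(1,p)} ≤ Tr P^{1/p}`, and the reverse Hölder inequality gives
`(Tr P^{1/p})^p ≤ Tr X₁^{1-p} P`.
-/

noncomputable section

namespace OperatorSpaceEntropy

open Matrix

open scoped Matrix.Norms.L2Operator NNReal Topology

section SuppPow

/-- The complex power `x ^ z` of a nonnegative real number, with value `0` at `x = 0` for every
exponent, including `z = 0`. Hence `z ↦ U diag(x ^ z) U*` is entire for every `x`, and its value at
`z = 0` is the support projection of `U diag(x) U*`. -/
def suppPow (x : ℝ≥0) (z : ℂ) : ℂ := if x = 0 then 0 else Complex.exp (z * Real.log x)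

@[simp]
lemma suppPow_zero_left (z : ℂ) : suppPow 0 z = 0 := if_pos rfl

lemma suppPow_ofReal {x : ℝ≥0} (hx : x ≠ 0) (r : ℝ) : suppPow x r = ((x ^ r : ℝ) : ℂ) := by
  rw [suppPow, if_neg hx, Real.rpow_def_of_pos (NNReal.coe_pos.2 (pos_iff_ne_zero.2 hx))]
  push_cast
  rw [mul_comm]

lemma suppPow_ofReal_of_ne_zero (x : ℝ≥0) {r : ℝ} (hr : r ≠ 0) :
    suppPow x r = ((x ^ r : ℝ) : ℂ) := by
  obtain rfl | hx := eq_or_ne x 0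
  · simp [Real.zero_rpow hr]
  · exact suppPow_ofReal hx r

@[simp]
lemma suppPow_one (x : ℝ≥0) : suppPow x 1 = ((x : ℝ) : ℂ) := by
  simpa using suppPow_ofReal_of_ne_zero x one_ne_zero

lemma suppPow_mul_suppPow (x : ℝ≥0) (z w : ℂ) :
    suppPow x z * suppPow x w = suppPow x (z + w) := by
  unfold suppPow
  split_ifs
  · simp
  · rw [← Complex.exp_add, add_mul]

lemma star_suppPow (x : ℝ≥0) (z : ℂ) : star (suppPow x z) = suppPow x (star z) := by
  unfold suppPow
  split_ifs
  · simp
  · simp only [Complex.star_def, ← Complex.exp_conj, map_mul, Complex.conj_ofReal]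

lemma norm_suppPow_le (x : ℝ≥0) (z : ℂ) : ‖suppPow x z‖ ≤ (x : ℝ) ^ z.re := by
  obtain rfl | hx := eq_or_ne x 0
  · simpa using Real.rpow_nonneg le_rfl _
  · rw [suppPow, if_neg hx, Complex.norm_exp,
      Real.rpow_def_of_pos (NNReal.coe_pos.2 (pos_iff_ne_zero.2 hx))]
    simp [mul_comm]

lemma norm_suppPow (x : ℝ≥0) {z : ℂ} (hz : z.re ≠ 0) : ‖suppPow x z‖ = (x : ℝ) ^ z.re := by
  obtain rfl | hx := eq_or_ne x 0
  · simp [Real.zero_rpow hz]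
  · rw [suppPow, if_neg hx, Complex.norm_exp,
      Real.rpow_def_of_pos (NNReal.coe_pos.2 (pos_iff_ne_zero.2 hx))]
    simp [mul_comm]

lemma norm_suppPow_le_one (x : ℝ≥0) {z : ℂ} (hz : z.re = 0) : ‖suppPow x z‖ ≤ 1 := by
  simpa [hz] using norm_suppPow_le x z

lemma norm_suppPow_ofReal_re (x : ℝ≥0) (z : ℂ) : ‖suppPow x z.re‖ = ‖suppPow x z‖ := by
  unfold suppPow
  split_ifs
  · rfl
  · simp [Complex.norm_exp]

lemma hasDerivAt_suppPow (x : ℝ≥0) (z : ℂ) :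
    HasDerivAt (suppPow x) (Real.log x * suppPow x z) z := by
  unfold suppPow
  split_ifs with h
  · simpa using hasDerivAt_const z (0 : ℂ)
  · simpa [mul_comm] using ((hasDerivAt_id z).mul_const (Real.log x : ℂ)).cexp

end SuppPow

section Udv

variable {ι : Type*} [Fintype ι] [DecidableEq ι]

/-- The product `U diag(d) V*` of a diagonal matrix with two unitary matrices: a spectral
decomposition if `U = V`, a singular value decomposition if `d` is nonnegative. -/
def udv (U V : unitaryGroup ι ℂ) (d : ι → ℂ) : Matrix ι ι ℂ := U.1 * diagonal d * star V.1

lemma udv_mul_udv (U V W : unitaryGroup ι ℂ) (d e : ι → ℂ) :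
    udv U V d * udv V W e = udv U W (d * e) := by
  simp_rw [udv, Matrix.mul_assoc]
  rw [← Matrix.mul_assoc (star V.1), Unitary.coe_star_mul_self, Matrix.one_mul,
    ← Matrix.mul_assoc (diagonal d), diagonal_mul_diagonal]
  rfl

lemma conjTranspose_udv (U V : unitaryGroup ι ℂ) (d : ι → ℂ) :
    (udv U V d)ᴴ = udv V U (star d) := by
  simp [udv, conjTranspose_mul, diagonal_conjTranspose, Matrix.mul_assoc, star_eq_conjTranspose]

lemma trace_udv_self (U : unitaryGroup ι ℂ) (d : ι → ℂ) : (udv U U d).trace = ∑ i, d i := by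
  rw [udv, trace_mul_comm, ← Matrix.mul_assoc, Unitary.coe_star_mul_self, Matrix.one_mul,
    trace_diagonal]

lemma trace_udv_mul_udv (S T U V : unitaryGroup ι ℂ) (d e : ι → ℂ) :
    (udv S T d * udv U V e).trace
      = ∑ i, ∑ j, d i * (star T * U).1 i j * (e j * (star V * S).1 j i) := by
  have h : (udv S T d * udv U V e).trace
      = (diagonal d * (star T * U).1 * (diagonal e * (star V * S).1)).trace := by
    rw [udv, Matrix.mul_assoc, Matrix.mul_assoc, trace_mul_comm]
    simp only [udv, Submonoid.coe_mul, Unitary.coe_star, Matrix.mul_assoc]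
  rw [h, trace]
  refine Finset.sum_congr rfl fun i _ => ?_
  rw [diag_apply, mul_apply]
  simp only [diagonal_mul]

lemma trace_udv_self_mul_udv_self (U V : unitaryGroup ι ℂ) (d e : ι → ℂ) :
    (udv U U d * udv V V e).trace = ∑ i, ∑ j, (‖(star U * V).1 i j‖ ^ 2 : ℝ) * (d i * e j) := by
  rw [trace_udv_mul_udv]
  refine Finset.sum_congr rfl fun i _ => Finset.sum_congr rfl fun j _ => ?_
  have h : (star V * U).1 j i = star ((star U * V).1 i j) := by
    rw [← star_apply, ← Unitary.coe_star, star_mul, star_star]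
  rw [h, Complex.ofReal_pow, ← Complex.mul_conj', Complex.star_def]
  ring

lemma normSq_unitary_mem_doublyStochastic (W : unitaryGroup ι ℂ) :
    Matrix.of (fun i j => ‖W.1 i j‖ ^ 2) ∈ doublyStochastic ℝ ι := by
  have hrow (W : unitaryGroup ι ℂ) (i : ι) : ∑ j, ‖W.1 i j‖ ^ 2 = 1 := by
    have h := congr($(Unitary.coe_mul_star_self W) i i)
    simp only [mul_apply, Unitary.coe_star, star_apply, Complex.star_def, Complex.mul_conj',
      one_apply_eq] at h
    exact_mod_cast h
  refine mem_doublyStochastic_iff_sum.2 ⟨fun i j => sq_nonneg _, hrow W, fun j => ?_⟩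
  simpa using hrow (star W) j

lemma cfc_udv (U : unitaryGroup ι ℂ) (x : ι → ℝ) (f : ℝ → ℝ) :
    cfc f (udv U U (fun i => x i)) = udv U U (fun i => f (x i)) := by
  have hX : (udv U U (fun i => x i)).IsHermitian := by
    rw [IsHermitian, conjTranspose_udv]
    congr 1
    ext i
    simp
  set W := hX.eigenvectorUnitary
  set l := hX.eigenvalues
  have spectral : udv U U (fun i => x i) = udv W W (fun i => l i) := hX.spectral_theorem
  have intertwine : (star W * U).1 * diagonal (fun i => (x i : ℂ))
      = diagonal (fun i => (l i : ℂ)) * (star W * U).1 := by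
    simpa [udv, Matrix.mul_assoc, mul_assoc, ← mul_assoc (star W.1) W.1] using
      congr(star W.1 * $spectral * U.1)
  have intertwine_cfc : (star W * U).1 * diagonal (fun i => (f (x i) : ℂ))
      = diagonal (fun i => (f (l i) : ℂ)) * (star W * U).1 := by
    ext i j
    have h := congr($intertwine i j)
    rw [mul_diagonal, diagonal_mul] at h ⊢
    obtain h0 | h0 := eq_or_ne ((star W * U).1 i j) 0
    · simp [h0]
    · rw [mul_comm, Complex.ofReal_inj.1 (mul_right_cancel₀ h0 ((mul_comm _ _).trans h))]
  have hcfc : cfc f (udv U U (fun i => x i)) = udv W W (fun i => f (l i)) := hX.cfc_eq f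
  rw [hcfc]
  simpa [udv, Matrix.mul_assoc, mul_assoc, ← mul_assoc W.1 (star W.1)] using
    congr(W.1 * $intertwine_cfc.symm * star U.1)

end Udv

section SvdPow

variable {ι : Type*} [Fintype ι] [DecidableEq ι]

/-- The product `U diag(s ^ z) V*`. For `U = V` it is the complex power of the positive semidefinite
matrix `U diag(s) U*`, equal to its support projection at `z = 0`. -/
def svdPow (U V : unitaryGroup ι ℂ) (s : ι → ℝ≥0) (z : ℂ) : Matrix ι ι ℂ :=
  udv U V fun i => suppPow (s i) z

/-- The logarithm of the positive semidefinite matrix `U diag(s) U*` on its support: it vanishes on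
the kernel, since `Real.log 0 = 0`. -/
def svdLog (U : unitaryGroup ι ℂ) (s : ι → ℝ≥0) : Matrix ι ι ℂ :=
  udv U U fun i => (Real.log (s i) : ℂ)

lemma svdPow_one (U V : unitaryGroup ι ℂ) (s : ι → ℝ≥0) :
    svdPow U V s 1 = udv U V fun i => ((s i : ℝ) : ℂ) := by
  simp only [svdPow, suppPow_one]

lemma svdPow_mul_svdPow (U V W : unitaryGroup ι ℂ) (s : ι → ℝ≥0) (z w : ℂ) :
    svdPow U V s z * svdPow V W s w = svdPow U W s (z + w) := by
  rw [svdPow, svdPow, udv_mul_udv]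
  simp only [svdPow, Pi.mul_def, suppPow_mul_suppPow]

lemma svdPow_mul_svdLog (U V : unitaryGroup ι ℂ) (s : ι → ℝ≥0) (z : ℂ) :
    svdPow U V s z * svdLog V s = svdLog U s * svdPow U V s z := by
  rw [svdPow, svdLog, svdLog, udv_mul_udv, udv_mul_udv, mul_comm]

lemma conjTranspose_svdPow (U V : unitaryGroup ι ℂ) (s : ι → ℝ≥0) (z : ℂ) :
    (svdPow U V s z)ᴴ = svdPow V U s (star z) := by
  simp only [svdPow, conjTranspose_udv, Pi.star_def, star_suppPow]

lemma svdPow_ofReal_eq_svdPow_one (U V : unitaryGroup ι ℂ) (s : ι → ℝ≥0) {r : ℝ} (hr : r ≠ 0) :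
    svdPow U V s r = svdPow U V (fun i => s i ^ r) 1 := by
  simp only [svdPow, suppPow_one, NNReal.coe_rpow, suppPow_ofReal_of_ne_zero _ hr]

lemma trace_svdPow_ofReal (U : unitaryGroup ι ℂ) (s : ι → ℝ≥0) {r : ℝ} (hr : r ≠ 0) :
    (svdPow U U s r).trace = ((∑ i, (s i : ℝ) ^ r : ℝ) : ℂ) := by
  rw [svdPow, trace_udv_self, Complex.ofReal_sum]
  simp only [suppPow_ofReal_of_ne_zero _ hr]

lemma posSemidef_svdPow_one (U : unitaryGroup ι ℂ) (s : ι → ℝ≥0) :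
    (svdPow U U s 1).PosSemidef := by
  have h : (diagonal fun i => ((s i : ℝ) : ℂ)).PosSemidef :=
    PosSemidef.diagonal fun i => by simp
  simpa only [svdPow_one, udv, star_eq_conjTranspose] using h.mul_mul_conjTranspose_same U.1

lemma exists_eq_svdPow_of_posSemidef {X : Matrix ι ι ℂ} (hX : X.PosSemidef) :
    ∃ (U : unitaryGroup ι ℂ) (x : ι → ℝ≥0), X = svdPow U U x 1 := by
  have spectral : X = udv hX.1.eigenvectorUnitary hX.1.eigenvectorUnitary
      fun i => (hX.1.eigenvalues i : ℂ) := hX.1.spectral_theorem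
  refine ⟨hX.1.eigenvectorUnitary, fun i => (hX.1.eigenvalues i).toNNReal, ?_⟩
  rw [svdPow_one]
  simpa only [Real.coe_toNNReal _ (hX.eigenvalues_nonneg _)] using spectral

lemma exists_unitary_mul_diagonal_sqrt {M : Matrix ι ι ℂ} {x : ι → ℝ≥0}
    (hM : Mᴴ * M = diagonal fun i => ((x i : ℝ) : ℂ)) :
    ∃ U : unitaryGroup ι ℂ, M = U.1 * diagonal fun i => ((NNReal.sqrt (x i) : ℝ) : ℂ) := by
  let col (i : ι) : EuclideanSpace ℂ ι := WithLp.toLp 2 (M.col i)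
  have inner_col (i j : ι) : inner ℂ (col i) (col j) = if i = j then ((x i : ℝ) : ℂ) else 0 := by
    rw [← diagonal_apply (fun i => ((x i : ℝ) : ℂ)), ← hM, mul_apply]
    simp [col, PiLp.inner_apply, mul_comm]
  let v (i : ι) : EuclideanSpace ℂ ι := ((NNReal.sqrt (x i) : ℝ) : ℂ)⁻¹ • col i
  have sqrt_ne {i : ι} (hi : x i ≠ 0) : ((NNReal.sqrt (x i) : ℝ) : ℂ) ≠ 0 := by simpa using hi
  have orthonormal_v : Orthonormal ℂ (({i | x i ≠ 0} : Set ι).domRestrict v) := by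
    rw [orthonormal_iff_ite]
    rintro ⟨i, hi⟩ ⟨j, hj⟩
    simp only [Set.domRestrict_apply, v, inner_smul_left, inner_smul_right, inner_col,
      Subtype.mk.injEq]
    split_ifs with hij
    · subst hij
      have h : ((x i : ℝ) : ℂ) = (NNReal.sqrt (x i) : ℝ) * (NNReal.sqrt (x i) : ℝ) := by
        rw [← Complex.ofReal_mul, ← NNReal.coe_mul, NNReal.mul_self_sqrt]
      rw [h, map_inv₀, Complex.conj_ofReal]
      have := sqrt_ne hi
      field_simp
    · simp
  obtain ⟨b, hb⟩ := orthonormal_v.exists_orthonormalBasis_extension_of_card_eq (by simp)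
  refine ⟨⟨_, (EuclideanSpace.basisFun ι ℂ).toMatrix_orthonormalBasis_mem_unitary b⟩, ?_⟩
  ext k i
  rw [mul_diagonal]
  simp only [Module.Basis.toMatrix_apply, OrthonormalBasis.coe_toBasis_repr_apply,
    EuclideanSpace.basisFun_repr]
  obtain hi | hi := eq_or_ne (x i) 0
  · have h : col i = 0 := inner_self_eq_zero.1 (by rw [inner_col, if_pos rfl, hi]; simp)
    simpa [hi, col] using congr($h k)
  · have h : b i k = ((NNReal.sqrt (x i) : ℝ) : ℂ)⁻¹ * M k i := by rw [hb i hi]; rfl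
    rw [h, mul_right_comm, inv_mul_cancel₀ (sqrt_ne hi), one_mul]

lemma exists_eq_svdPow (A : Matrix ι ι ℂ) :
    ∃ (U V : unitaryGroup ι ℂ) (s : ι → ℝ≥0), A = svdPow U V s 1 := by
  obtain ⟨V, x, h⟩ := exists_eq_svdPow_of_posSemidef (posSemidef_conjTranspose_mul_self A)
  have hAV : (A * V.1)ᴴ * (A * V.1) = diagonal fun i => ((x i : ℝ) : ℂ) := by
    rw [conjTranspose_mul, Matrix.mul_assoc, ← Matrix.mul_assoc Aᴴ, h, svdPow_one, udv]
    simp [← Matrix.mul_assoc, ← star_eq_conjTranspose, Matrix.mul_assoc _ (star V.1)]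
  obtain ⟨U, hU⟩ := exists_unitary_mul_diagonal_sqrt hAV
  refine ⟨U, V, fun i => NNReal.sqrt (x i), ?_⟩
  rw [svdPow_one, udv, ← hU, Matrix.mul_assoc, ← Unitary.coe_star,
    Unitary.coe_mul_star_self, Matrix.mul_one]

end SvdPow

section Norms

variable {ι : Type*} [Fintype ι] [DecidableEq ι]

lemma norm_udv (U V : unitaryGroup ι ℂ) (d : ι → ℂ) : ‖udv U V d‖ = ‖d‖ := by
  rw [udv, ← Unitary.coe_star, CStarRing.norm_mul_coe_unitary, CStarRing.norm_coe_unitary_mul,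
    l2_opNorm_diagonal]

lemma norm_svdPow_le_one (U V : unitaryGroup ι ℂ) (s : ι → ℝ≥0) {z : ℂ} (hz : z.re = 0) :
    ‖svdPow U V s z‖ ≤ 1 := by
  rw [svdPow, norm_udv]
  exact (pi_norm_le_iff_of_nonneg zero_le_one).2 fun i => norm_suppPow_le_one _ hz

lemma norm_apply_le_norm (K : Matrix ι ι ℂ) (i j : ι) : ‖K i j‖ ≤ ‖K‖ := by
  have h := (PiLp.norm_apply_le _ i).trans (l2_opNorm_mulVec K (EuclideanSpace.single j 1))
  simpa using h

lemma matAbs_udv (U V : unitaryGroup ι ℂ) (d : ι → ℂ) :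
    matAbs (udv U V d) = udv V V fun i => (‖d i‖ : ℂ) := by
  have h : (udv U V d)ᴴ * udv U V d = udv V V fun i => ((‖d i‖ ^ 2 : ℝ) : ℂ) := by
    rw [conjTranspose_udv, udv_mul_udv]
    congr 1
    ext i
    simp [Complex.conj_mul']
  rw [matAbs, h, cfc_udv]
  simp

lemma schattenNorm_udv (p : ℝ) (U V : unitaryGroup ι ℂ) (d : ι → ℂ) :
    schattenNorm p (udv U V d) = (∑ i, ‖d i‖ ^ p) ^ (1 / p) := by
  rw [schattenNorm, matAbs_udv, cfc_udv, trace_udv_self]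
  simp [← Complex.ofReal_sum]

lemma schattenNorm_svdPow (p : ℝ) (U V : unitaryGroup ι ℂ) (s : ι → ℝ≥0) {z : ℂ}
    (hz : z.re ≠ 0) :
    schattenNorm p (svdPow U V s z) = (∑ i, (s i : ℝ) ^ (z.re * p)) ^ (1 / p) := by
  simp only [svdPow, schattenNorm_udv, norm_suppPow _ hz, ← Real.rpow_mul (NNReal.coe_nonneg _)]

lemma schattenNorm_svdPow_one (p : ℝ) (U V : unitaryGroup ι ℂ) (s : ι → ℝ≥0) :
    schattenNorm p (svdPow U V s 1) = (∑ i, (s i : ℝ) ^ p) ^ (1 / p) := by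
  simpa using schattenNorm_svdPow p U V s (z := 1) (by simp)

lemma schattenNorm_nonneg (p : ℝ) (A : Matrix ι ι ℂ) : 0 ≤ schattenNorm p A := by
  obtain ⟨U, V, s, rfl⟩ := exists_eq_svdPow A
  rw [schattenNorm_svdPow_one]
  positivity

lemma schattenNorm_zero {p : ℝ} (hp : p ≠ 0) : schattenNorm p (0 : Matrix ι ι ℂ) = 0 := by
  have h : (0 : Matrix ι ι ℂ) = udv 1 1 0 := by simp [udv]
  rw [h, schattenNorm_udv]
  simp [Real.zero_rpow, hp]

lemma norm_le_schattenNorm {p : ℝ} (hp : 0 < p) (A : Matrix ι ι ℂ) : ‖A‖ ≤ schattenNorm p A := by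
  obtain ⟨U, V, s, rfl⟩ := exists_eq_svdPow A
  rw [schattenNorm_svdPow_one, svdPow_one, norm_udv]
  refine (pi_norm_le_iff_of_nonneg (by positivity)).2 fun i => ?_
  rw [Complex.norm_real, NNReal.norm_eq, one_div,
    Real.le_rpow_inv_iff_of_pos (by positivity) (by positivity) hp]
  exact Finset.single_le_sum (f := fun i => (s i : ℝ) ^ p) (fun _ _ => by positivity)
    (Finset.mem_univ i)

lemma schattenNorm_pos {p : ℝ} (hp : 0 < p) {A : Matrix ι ι ℂ} (hA : A ≠ 0) :
    0 < schattenNorm p A :=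
  (norm_pos_iff.2 hA).trans_le (norm_le_schattenNorm hp A)

lemma schattenNorm_one_of_posSemidef {X : Matrix ι ι ℂ} (hX : X.PosSemidef) :
    schattenNorm 1 X = X.trace.re := by
  obtain ⟨U, x, rfl⟩ := exists_eq_svdPow_of_posSemidef hX
  rw [schattenNorm_svdPow_one, div_one, Real.rpow_one, ← Complex.ofReal_one,
    trace_svdPow_ofReal _ _ one_ne_zero, Complex.ofReal_re]

lemma schattenNorm_le_card_rpow_mul_norm {p : ℝ} (hp : 0 < p) (A : Matrix ι ι ℂ) :
    schattenNorm p A ≤ (Fintype.card ι : ℝ) ^ (1 / p) * ‖A‖ := by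
  obtain ⟨U, V, s, rfl⟩ := exists_eq_svdPow A
  rw [svdPow_one, norm_udv, schattenNorm_udv]
  set d : ι → ℂ := fun i => ((s i : ℝ) : ℂ)
  calc (∑ i, ‖d i‖ ^ p) ^ (1 / p) ≤ (∑ _i : ι, ‖d‖ ^ p) ^ (1 / p) := by
        gcongr with i
        exact norm_le_pi_norm d i
    _ = (Fintype.card ι : ℝ) ^ (1 / p) * ‖d‖ := by
        rw [Finset.sum_const, nsmul_eq_mul, Finset.card_univ,
          Real.mul_rpow (by positivity) (by positivity), one_div,
          Real.rpow_rpow_inv (norm_nonneg _) hp.ne']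

lemma vnEntropy_svdPow_one (U : unitaryGroup ι ℂ) (x : ι → ℝ≥0) :
    vnEntropy (svdPow U U x 1) = -∑ i, (x i : ℝ) * Real.log (x i) := by
  rw [vnEntropy, svdPow_one, cfc_udv, trace_udv_self, ← Complex.ofReal_sum, Complex.ofReal_re]

end Norms

section Holder

variable {ι κ : Type*} [Fintype ι] [Fintype κ]

lemma sum_mul_mul_le_of_substochastic {p q : ℝ} (hpq : p.HolderConjugate q) {c : ι → κ → ℝ}
    {f : ι → ℝ} {g : κ → ℝ} (hc : ∀ i j, 0 ≤ c i j) (hrow : ∀ i, ∑ j, c i j ≤ 1)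
    (hcol : ∀ j, ∑ i, c i j ≤ 1) (hf : ∀ i, 0 ≤ f i) (hg : ∀ j, 0 ≤ g j) :
    ∑ i, ∑ j, c i j * (f i * g j) ≤ (∑ i, f i ^ p) ^ (1 / p) * (∑ j, g j ^ q) ^ (1 / q) := by
  have split (i : ι) (j : κ) :
      c i j * (f i * g j) = c i j ^ p⁻¹ * f i * (c i j ^ q⁻¹ * g j) := by
    rw [mul_mul_mul_comm, ← Real.rpow_add_of_nonneg (hc i j) hpq.inv_nonneg hpq.symm.inv_nonneg,
      hpq.inv_add_inv_eq_one, Real.rpow_one]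
  have pow_split {r x y : ℝ} (hr : r ≠ 0) (hx : 0 ≤ x) (hy : 0 ≤ y) :
      (x ^ r⁻¹ * y) ^ r = x * y ^ r := by
    rw [Real.mul_rpow (by positivity) hy, Real.rpow_inv_rpow hx hr]
  have holder := Real.inner_le_Lp_mul_Lq_of_nonneg (Finset.univ : Finset (ι × κ))
    (f := fun k => c k.1 k.2 ^ p⁻¹ * f k.1) (g := fun k => c k.1 k.2 ^ q⁻¹ * g k.2) hpq
    (fun k _ => mul_nonneg (Real.rpow_nonneg (hc _ _) _) (hf _))
    (fun k _ => mul_nonneg (Real.rpow_nonneg (hc _ _) _) (hg _))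
  simp only [pow_split hpq.ne_zero (hc _ _) (hf _), pow_split hpq.symm.ne_zero (hc _ _) (hg _),
    ← split, Fintype.sum_prod_type] at holder
  refine holder.trans ?_
  have hfp (i : ι) : 0 ≤ f i ^ p := Real.rpow_nonneg (hf i) p
  have hgq (j : κ) : 0 ≤ g j ^ q := Real.rpow_nonneg (hg j) q
  have := hpq.one_div_nonneg
  have := hpq.symm.one_div_nonneg
  rw [Finset.sum_comm (f := fun i j => c i j * g j ^ q)]
  simp only [← Finset.sum_mul]
  have := Finset.sum_nonneg fun i (_ : i ∈ Finset.univ) =>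
    mul_nonneg (Finset.sum_nonneg fun j (_ : j ∈ Finset.univ) => hc i j) (hfp i)
  have := Finset.sum_nonneg fun j (_ : j ∈ Finset.univ) =>
    mul_nonneg (Finset.sum_nonneg fun i (_ : i ∈ Finset.univ) => hc i j) (hgq j)
  have := Finset.sum_nonneg fun i (_ : i ∈ Finset.univ) => hfp i
  gcongr with i _ j _
  · exact mul_le_of_le_one_left (hfp i) (hrow i)
  · exact mul_le_of_le_one_left (hgq j) (hcol j)

lemma sum_mul_rpow_inv_le_of_sum_eq_one {p : ℝ} {c ξ y : κ → ℝ} (hp : 1 ≤ p)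
    (hc : ∀ k, 0 ≤ c k) (hξ : ∀ k, 0 ≤ ξ k) (hy : ∀ k, 0 ≤ y k) (hsum : ∑ k, c k * ξ k = 1)
    (hsupp : ∀ k, ξ k = 0 → c k * y k = 0) :
    (∑ k, c k * y k ^ p⁻¹) ^ p ≤ ∑ k, c k * (ξ k * (ξ k)⁻¹ ^ p * y k) := by
  have hp0 : 0 < p := zero_lt_one.trans_le hp
  have cancel (k : κ) : c k * ξ k * (y k ^ p⁻¹ * (ξ k)⁻¹) = c k * y k ^ p⁻¹ := by
    by_cases h : ξ k = 0
    · obtain hk | hk := mul_eq_zero.1 (hsupp k h)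
      · simp [hk]
      · simp [h, hk, Real.zero_rpow (inv_ne_zero hp0.ne')]
    · field_simp
  have pow (k : κ) :
      c k * ξ k * (y k ^ p⁻¹ * (ξ k)⁻¹) ^ p = c k * (ξ k * (ξ k)⁻¹ ^ p * y k) := by
    rw [Real.mul_rpow (Real.rpow_nonneg (hy k) _) (inv_nonneg.2 (hξ k)),
      Real.rpow_inv_rpow (hy k) hp0.ne']
    ring
  have holder := Real.inner_le_weight_mul_Lp_of_nonneg Finset.univ hp (fun k => c k * ξ k)
    (fun k => y k ^ p⁻¹ * (ξ k)⁻¹) (fun k => mul_nonneg (hc k) (hξ k))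
    fun k => mul_nonneg (Real.rpow_nonneg (hy k) _) (inv_nonneg.2 (hξ k))
  simp only [cancel, pow, hsum, Real.one_rpow, one_mul] at holder
  exact (Real.le_rpow_inv_iff_of_pos
    (Finset.sum_nonneg fun k _ => mul_nonneg (hc k) (Real.rpow_nonneg (hy k) _))
    (Finset.sum_nonneg fun k _ => mul_nonneg (hc k) (mul_nonneg (mul_nonneg (hξ k)
      (Real.rpow_nonneg (inv_nonneg.2 (hξ k)) _)) (hy k))) hp0).1 holder

variable [DecidableEq ι]

lemma sum_norm_mul_norm_le_one (U V : unitaryGroup ι ℂ) (i : ι) :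
    ∑ j, ‖U.1 i j‖ * ‖V.1 j i‖ ≤ 1 := by
  have hU := (mem_doublyStochastic_iff_sum.1 (normSq_unitary_mem_doublyStochastic U)).2.1 i
  have hV := (mem_doublyStochastic_iff_sum.1 (normSq_unitary_mem_doublyStochastic V)).2.2 i
  have h := Finset.sum_mul_sq_le_sq_mul_sq Finset.univ (fun j => ‖U.1 i j‖) (fun j => ‖V.1 j i‖)
  simp only [of_apply] at hU hV
  rw [hU, hV, one_mul] at h
  exact (le_abs_self _).trans ((sq_le_one_iff_abs_le_one _).1 h)

lemma norm_trace_mul_le {p q : ℝ} (hpq : p.HolderConjugate q) (A B : Matrix ι ι ℂ) :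
    ‖(A * B).trace‖ ≤ schattenNorm p A * schattenNorm q B := by
  obtain ⟨S, T, s, rfl⟩ := exists_eq_svdPow A
  obtain ⟨U, V, x, rfl⟩ := exists_eq_svdPow B
  rw [schattenNorm_svdPow_one, schattenNorm_svdPow_one, svdPow_one, svdPow_one, trace_udv_mul_udv]
  refine le_trans ?_ (sum_mul_mul_le_of_substochastic hpq
    (c := fun i j => ‖(star T * U).1 i j‖ * ‖(star V * S).1 j i‖)
    (fun i j => by positivity) (fun i => sum_norm_mul_norm_le_one _ _ i)
    (fun j => by simpa only [mul_comm] using sum_norm_mul_norm_le_one (star V * S) (star T * U) j)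
    (fun i => NNReal.coe_nonneg (s i)) (fun j => NNReal.coe_nonneg (x j)))
  refine (norm_sum_le _ _).trans (Finset.sum_le_sum fun i _ => (norm_sum_le _ _).trans_eq ?_)
  refine Finset.sum_congr rfl fun j _ => ?_
  simp only [norm_mul, Complex.norm_real, NNReal.norm_eq]
  ring

lemma norm_trace_mul_le_schattenNorm_one_mul_norm (A K : Matrix ι ι ℂ) :
    ‖(A * K).trace‖ ≤ schattenNorm 1 A * ‖K‖ := by
  obtain ⟨S, T, s, rfl⟩ := exists_eq_svdPow A
  have h : (svdPow S T s 1 * K).trace = ∑ i, ((s i : ℝ) : ℂ) * (star T.1 * K * S.1) i i := by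
    rw [svdPow_one, udv, Matrix.mul_assoc, Matrix.mul_assoc, trace_mul_comm, Matrix.mul_assoc,
      trace]
    simp only [diag_apply, diagonal_mul, Matrix.mul_assoc]
  have hK (i : ι) : ‖(star T.1 * K * S.1) i i‖ ≤ ‖K‖ := by
    refine (norm_apply_le_norm _ i i).trans_eq ?_
    rw [CStarRing.norm_mul_coe_unitary, ← Unitary.coe_star, CStarRing.norm_coe_unitary_mul]
  rw [h, schattenNorm_svdPow_one]
  simp only [Real.rpow_one, div_one, Finset.sum_mul]
  refine (norm_sum_le _ _).trans (Finset.sum_le_sum fun i _ => ?_)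
  rw [norm_mul, Complex.norm_real, NNReal.norm_eq]
  exact mul_le_mul_of_nonneg_left (hK i) (NNReal.coe_nonneg _)

lemma schattenNorm_two_sq (A : Matrix ι ι ℂ) : schattenNorm 2 A ^ 2 = (A * Aᴴ).trace.re := by
  obtain ⟨S, T, s, rfl⟩ := exists_eq_svdPow A
  have h : svdPow S T s 1 * (svdPow S T s 1)ᴴ = svdPow S S s (2 : ℝ) := by
    rw [conjTranspose_svdPow, svdPow_mul_svdPow]
    norm_num
  rw [h, trace_svdPow_ofReal _ _ two_ne_zero, Complex.ofReal_re, schattenNorm_svdPow_one,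
    ← Real.sqrt_eq_rpow, Real.sq_sqrt (by positivity)]

lemma schattenNorm_one_conjTranspose_mul_self (A : Matrix ι ι ℂ) :
    schattenNorm 1 (Aᴴ * A) = schattenNorm 2 A ^ 2 := by
  obtain ⟨S, T, s, rfl⟩ := exists_eq_svdPow A
  rw [conjTranspose_svdPow, svdPow_mul_svdPow, schattenNorm_svdPow _ _ _ _ (by simp),
    schattenNorm_svdPow_one, ← Real.sqrt_eq_rpow, Real.sq_sqrt (by positivity)]
  norm_num

lemma schattenNorm_two_mul_le (A K : Matrix ι ι ℂ) :
    schattenNorm 2 (A * K) ≤ schattenNorm 2 A * ‖K‖ := by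
  refine le_of_sq_le_sq ?_ (mul_nonneg (schattenNorm_nonneg 2 A) (norm_nonneg K))
  have h : (A * K * (A * K)ᴴ).trace = (Aᴴ * A * (K * Kᴴ)).trace := by
    rw [conjTranspose_mul, ← Matrix.mul_assoc, trace_mul_comm]
    simp only [Matrix.mul_assoc]
  calc schattenNorm 2 (A * K) ^ 2 ≤ ‖(Aᴴ * A * (K * Kᴴ)).trace‖ := by
        rw [schattenNorm_two_sq, h]
        exact Complex.re_le_norm _
    _ ≤ schattenNorm 1 (Aᴴ * A) * ‖K * Kᴴ‖ := norm_trace_mul_le_schattenNorm_one_mul_norm _ _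
    _ = (schattenNorm 2 A * ‖K‖) ^ 2 := by
        rw [schattenNorm_one_conjTranspose_mul_self, ← star_eq_conjTranspose,
          CStarRing.norm_self_mul_star, mul_pow, sq ‖K‖]

lemma schattenNorm_conjTranspose (p : ℝ) (A : Matrix ι ι ℂ) :
    schattenNorm p Aᴴ = schattenNorm p A := by
  obtain ⟨S, T, s, rfl⟩ := exists_eq_svdPow A
  rw [conjTranspose_svdPow, star_one, schattenNorm_svdPow_one, schattenNorm_svdPow_one]

lemma schattenNorm_one_mul_le (A B : Matrix ι ι ℂ) :
    schattenNorm 1 (A * B) ≤ schattenNorm 2 A * schattenNorm 2 B := by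
  obtain ⟨S, T, s, h⟩ := exists_eq_svdPow (A * B)
  set K := svdPow T S s 0
  have trace_eq : (A * (B * K)).trace = schattenNorm 1 (A * B) := by
    rw [← Matrix.mul_assoc, h, svdPow_mul_svdPow, add_zero, schattenNorm_svdPow_one, div_one,
      Real.rpow_one, ← Complex.ofReal_one, trace_svdPow_ofReal _ _ one_ne_zero]
  calc schattenNorm 1 (A * B) = ‖(A * (B * K)).trace‖ := by
        rw [trace_eq, Complex.norm_real, Real.norm_of_nonneg (schattenNorm_nonneg 1 _)]
    _ ≤ schattenNorm 2 A * schattenNorm 2 (B * K) :=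
        norm_trace_mul_le Real.HolderConjugate.two_two A _
    _ ≤ schattenNorm 2 A * schattenNorm 2 B := by
        refine mul_le_mul_of_nonneg_left ?_ (schattenNorm_nonneg 2 A)
        exact (schattenNorm_two_mul_le B K).trans <|
          mul_le_of_le_one_right (schattenNorm_nonneg 2 B) (norm_svdPow_le_one T S s rfl)

end Holder

section Gibbs

variable {ι : Type*} [Fintype ι] [DecidableEq ι]

lemma mul_log_le {x a N : ℝ} (hx : 0 < x) (ha : 0 < a) (hN : 0 < N) :
    x * Real.log a ≤ x * Real.log x + x * Real.log N + a / N - x := by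
  have h := Real.log_le_sub_one_of_pos (div_pos (div_pos ha hN) hx)
  rw [Real.log_div (by positivity) hx.ne', Real.log_div ha.ne' hN.ne'] at h
  have := mul_le_mul_of_nonneg_left h hx.le
  rw [mul_sub x (a / N / x), mul_div_cancel₀ _ hx.ne'] at this
  linarith

/-- Gibbs' inequality for the coupling `c i j * x j` of two bases. -/
lemma sum_mul_log_le_of_doublyStochastic {c : Matrix ι ι ℝ} (hc : c ∈ doublyStochastic ℝ ι)
    {a x : ι → ℝ} (ha : ∀ i, 0 ≤ a i) (hx : ∀ i, 0 ≤ x i) (hx_sum : ∑ i, x i = 1)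
    (hsupp : ∀ i j, a i = 0 → c i j * x j = 0) :
    ∑ i, ∑ j, c i j * (Real.log (a i) * x j)
      ≤ ∑ j, x j * Real.log (x j) + Real.log (∑ i, a i) := by
  obtain ⟨hc0, hrow, hcol⟩ := mem_doublyStochastic_iff_sum.1 hc
  have sum_right (f : ι → ℝ) : ∑ i, ∑ j, c i j * f j = ∑ j, f j := by
    rw [Finset.sum_comm]
    simp only [← Finset.sum_mul, hcol, one_mul]
  have sum_left (f : ι → ℝ) : ∑ i, ∑ j, c i j * f i = ∑ i, f i := by
    simp only [← Finset.sum_mul, hrow, one_mul]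
  set N := ∑ i, a i
  have hN : 0 < N := by
    refine (Finset.sum_nonneg fun i _ => ha i).lt_of_ne' fun h => one_ne_zero (α := ℝ) ?_
    rw [← hx_sum, ← sum_right]
    refine Finset.sum_eq_zero fun i _ => Finset.sum_eq_zero fun j _ => hsupp i j ?_
    exact (Finset.sum_eq_zero_iff_of_nonneg fun i _ => ha i).1 h i (Finset.mem_univ i)
  have term_le (i j : ι) : c i j * (Real.log (a i) * x j)
      ≤ c i j * (x j * Real.log (x j) + x j * Real.log N - x j) + c i j * (a i / N) := by
    obtain hxj | hxj := (hx j).eq_or_lt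
    · simpa [← hxj] using mul_nonneg (hc0 i j) (div_nonneg (ha i) hN.le)
    obtain hai | hai := (ha i).eq_or_lt
    · simp [(mul_eq_zero.1 (hsupp i j hai.symm)).resolve_right hxj.ne']
    · rw [← mul_add]
      refine mul_le_mul_of_nonneg_left ?_ (hc0 i j)
      linarith [mul_log_le hxj hai hN, mul_comm (x j) (Real.log (a i))]
  refine (Finset.sum_le_sum fun i _ => Finset.sum_le_sum fun j _ => term_le i j).trans_eq ?_
  simp only [Finset.sum_add_distrib]
  rw [sum_right, sum_left, Finset.sum_sub_distrib, Finset.sum_add_distrib, ← Finset.sum_mul,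
    ← Finset.sum_div, hx_sum, div_self hN.ne']
  ring

lemma overlap_mul_eq_zero {U V : unitaryGroup ι ℂ} {s x : ι → ℝ≥0}
    (h : svdPow U U s 0 * svdPow V V x 1 = svdPow V V x 1) {i : ι} (hi : s i = 0) (j : ι) :
    ‖(star U * V).1 i j‖ ^ 2 * (x j : ℝ) = 0 := by
  have hij : (star U * V).1 i j * ((x j : ℝ) : ℂ) = 0 := by
    have hE := congr((star U.1 * $h * V.1) i j)
    have hl : star U.1 * (svdPow U U s 0 * svdPow V V x 1) * V.1
      = diagonal (fun i => suppPow (s i) 0) * (star U.1 * svdPow V V x 1 * V.1) := by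
      rw [svdPow, udv]
      simp only [← Matrix.mul_assoc]
      rw [Unitary.coe_star_mul_self, Matrix.one_mul]
    have hr : star U.1 * svdPow V V x 1 * V.1
        = (star U * V).1 * diagonal fun j => ((x j : ℝ) : ℂ) := by
      simp [svdPow, udv, Matrix.mul_assoc]
    rw [hl, hr, diagonal_mul, mul_diagonal, hi, suppPow_zero_left, zero_mul] at hE
    exact hE.symm
  obtain h | h := mul_eq_zero.1 hij
  · simp [h]
  · simp [Complex.ofReal_eq_zero.1 h]

/-- Klein's inequality. -/
lemma trace_log_mul_le {U : unitaryGroup ι ℂ} {s : ι → ℝ≥0} {Q : Matrix ι ι ℂ}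
    (hQ : Q.PosSemidef) (hQ_trace : Q.trace = 1) (hsupp : svdPow U U s 0 * Q = Q) :
    (svdLog U s * Q).trace.re
      ≤ -vnEntropy Q + Real.log (∑ i, (s i : ℝ)) := by
  obtain ⟨V, x, rfl⟩ := exists_eq_svdPow_of_posSemidef hQ
  have hx_sum : ∑ i, (x i : ℝ) = 1 := by
    rw [svdPow_one, trace_udv_self] at hQ_trace
    exact_mod_cast hQ_trace
  have h := sum_mul_log_le_of_doublyStochastic (normSq_unitary_mem_doublyStochastic (star U * V))
    (fun i => NNReal.coe_nonneg (s i)) (fun i => NNReal.coe_nonneg (x i)) hx_sum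
    fun i j hi => overlap_mul_eq_zero hsupp (NNReal.coe_eq_zero.1 hi) j
  rw [vnEntropy_svdPow_one, neg_neg, svdPow_one, svdLog, trace_udv_self_mul_udv_self]
  convert h
  norm_cast

end Gibbs

section Amp

variable {m n : ℕ}

variable (m n) in
/-- The amplification `A ↦ A ⊗ I`. -/
def amp : Matrix (Fin m) (Fin m) ℂ →⋆ₐ[ℂ] Matrix (Fin m × Fin n) (Fin m × Fin n) ℂ where
  toFun A := A ⊗ₖ (1 : Matrix (Fin n) (Fin n) ℂ)
  map_one' := one_kronecker_one
  map_mul' A B := by rw [← mul_kronecker_mul, Matrix.one_mul]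
  map_zero' := zero_kronecker _
  map_add' A B := add_kronecker A B _
  commutes' r := by
    ext ⟨i, j⟩ ⟨k, l⟩
    simp [algebraMap_matrix_apply, kroneckerMap_apply, one_apply, Prod.ext_iff, ← ite_and, and_comm]
  map_star' A := by
    rw [star_eq_conjTranspose, star_eq_conjTranspose, conjTranspose_kronecker, conjTranspose_one]

lemma amp_conjTranspose (A : Matrix (Fin m) (Fin m) ℂ) : amp m n Aᴴ = (amp m n A)ᴴ :=
  map_star (amp m n) A

lemma norm_amp_le (A : Matrix (Fin m) (Fin m) ℂ) : ‖amp m n A‖ ≤ ‖A‖ :=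
  NonUnitalStarAlgHom.norm_apply_le (amp m n) A

lemma partialTrace₂_amp_mul (A : Matrix (Fin m) (Fin m) ℂ)
    (X : Matrix (Fin m × Fin n) (Fin m × Fin n) ℂ) :
    partialTrace₂ (amp m n A * X) = A * partialTrace₂ X := by
  ext i k
  have h (j : Fin n) : (amp m n A * X) (i, j) (k, j) = ∑ l, A i l * X (l, j) (k, j) := by
    simp [amp, mul_apply, Fintype.sum_prod_type, one_apply]
  rw [mul_apply]
  simp only [partialTrace₂, of_apply, h, Finset.mul_sum]
  exact Finset.sum_comm

lemma trace_partialTrace₂ (X : Matrix (Fin m × Fin n) (Fin m × Fin n) ℂ) :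
    (partialTrace₂ X).trace = X.trace := by
  simp [partialTrace₂, trace, Fintype.sum_prod_type]

lemma trace_amp_mul (A : Matrix (Fin m) (Fin m) ℂ)
    (X : Matrix (Fin m × Fin n) (Fin m × Fin n) ℂ) :
    (amp m n A * X).trace = (A * partialTrace₂ X).trace := by
  rw [← trace_partialTrace₂, partialTrace₂_amp_mul]

lemma posSemidef_partialTrace₂ {X : Matrix (Fin m × Fin n) (Fin m × Fin n) ℂ}
    (hX : X.PosSemidef) : (partialTrace₂ X).PosSemidef := by
  have h : partialTrace₂ X = ∑ j : Fin n, X.submatrix (fun i => (i, j)) (fun i => (i, j)) := by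
    ext i k
    simp [partialTrace₂, Matrix.sum_apply]
  rw [h]
  exact posSemidef_sum _ fun j _ => hX.submatrix _

lemma schattenNorm_two_amp_mul {K : Matrix (Fin m × Fin n) (Fin m × Fin n) ℂ}
    {L : Matrix (Fin m) (Fin m) ℂ} (h : partialTrace₂ (K * Kᴴ) = L * Lᴴ)
    (C : Matrix (Fin m) (Fin m) ℂ) : schattenNorm 2 (amp m n C * K) = schattenNorm 2 (C * L) := by
  have htrace : (amp m n C * K * (amp m n C * K)ᴴ).trace = (C * L * (C * L)ᴴ).trace := by
    calc (amp m n C * K * (amp m n C * K)ᴴ).trace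
        = (amp m n (Cᴴ * C) * (K * Kᴴ)).trace := by
          rw [conjTranspose_mul, ← Matrix.mul_assoc, trace_mul_comm, map_mul, amp_conjTranspose]
          simp only [Matrix.mul_assoc]
      _ = (C * L * (C * L)ᴴ).trace := by
          rw [trace_amp_mul, h, conjTranspose_mul, ← Matrix.mul_assoc (C * L), trace_mul_comm _ Cᴴ]
          simp only [Matrix.mul_assoc]
  rw [← sq_eq_sq₀ (schattenNorm_nonneg _ _) (schattenNorm_nonneg _ _), schattenNorm_two_sq,
    schattenNorm_two_sq, htrace]

lemma amp_svdPow_zero_mul_svdPow {U : unitaryGroup (Fin m × Fin n) ℂ} {x : Fin m × Fin n → ℝ≥0}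
    {V : unitaryGroup (Fin m) ℂ} {y : Fin m → ℝ≥0} {r : ℝ}
    (h : partialTrace₂ (svdPow U U x r) = svdPow V V y 1) (z : ℂ) :
    amp m n (svdPow V V y 0) * svdPow U U x z = svdPow U U x z := by
  set K := svdPow U U x (r / 2 : ℝ)
  have hK : K * Kᴴ = svdPow U U x r := by
    rw [conjTranspose_svdPow, svdPow_mul_svdPow, Complex.star_def, Complex.conj_ofReal,
      ← Complex.ofReal_add, add_halves]
  have hL : svdPow V V y (1 / 2 : ℝ) * (svdPow V V y (1 / 2 : ℝ))ᴴ = svdPow V V y 1 := by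
    rw [conjTranspose_svdPow, svdPow_mul_svdPow, Complex.star_def, Complex.conj_ofReal,
      ← Complex.ofReal_add, add_halves, Complex.ofReal_one]
  have hzero : amp m n (1 - svdPow V V y 0) * K = 0 := by
    refine norm_le_zero_iff.1 ((norm_le_schattenNorm two_pos _).trans_eq ?_)
    rw [schattenNorm_two_amp_mul (by rw [hK, h, hL]), Matrix.sub_mul, svdPow_mul_svdPow, zero_add,
      Matrix.one_mul, sub_self, schattenNorm_zero two_ne_zero]
  have hfactor : svdPow U U x z = K * svdPow U U x (z - (r / 2 : ℝ)) := by
    rw [svdPow_mul_svdPow, add_sub_cancel]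
  have := congr($hzero * svdPow U U x (z - (r / 2 : ℝ)))
  rw [Matrix.mul_assoc, ← hfactor, map_sub, map_one, Matrix.sub_mul, Matrix.one_mul,
    Matrix.zero_mul, sub_eq_zero] at this
  exact this.symm

end Amp

section StripBounded

variable {E F : Type*} [NormedAddCommGroup E] [NormedSpace ℂ E] [NormedAddCommGroup F]
  [NormedSpace ℂ F]

/-- Entire functions that are bounded on the strip `0 ≤ re z ≤ 1`, to which the three lines theorem
applies. -/
def StripBounded (f : ℂ → E) : Prop :=
  Differentiable ℂ f ∧ ∃ C, ∀ z : ℂ, 0 ≤ z.re → z.re ≤ 1 → ‖f z‖ ≤ C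

lemma StripBounded.const (c : E) : StripBounded fun _ => c :=
  ⟨differentiable_const c, ‖c‖, fun _ _ _ => le_rfl⟩

lemma StripBounded.mul {A : Type*} [NormedRing A] [NormedAlgebra ℂ A] {f g : ℂ → A}
    (hf : StripBounded f) (hg : StripBounded g) : StripBounded fun z => f z * g z := by
  obtain ⟨hf, C, hC⟩ := hf
  obtain ⟨hg, D, hD⟩ := hg
  refine ⟨hf.mul hg, C * D, fun z h0 h1 => (norm_mul_le _ _).trans ?_⟩
  exact mul_le_mul (hC z h0 h1) (hD z h0 h1) (norm_nonneg _) ((norm_nonneg _).trans (hC z h0 h1))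

lemma StripBounded.clm_comp {f : ℂ → E} (hf : StripBounded f) (T : E →L[ℂ] F) :
    StripBounded fun z => T (f z) := by
  obtain ⟨hf, C, hC⟩ := hf
  exact ⟨T.differentiable.comp hf, ‖T‖ * C, fun z h0 h1 => T.le_opNorm_of_le (hC z h0 h1)⟩

open Complex.HadamardThreeLines in
lemma StripBounded.norm_le_rpow_mul_rpow {f : ℂ → E} (hf : StripBounded f) {e a b t : ℝ}
    (he : 0 < e) (he1 : e ≤ 1) (ha : ∀ z : ℂ, z.re = 0 → ‖f z‖ ≤ a)
    (hb : ∀ z : ℂ, z.re = e → ‖f z‖ ≤ b) (ht : 0 ≤ t) (hte : t ≤ e) :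
    ‖f t‖ ≤ a ^ (1 - t / e) * b ^ (t / e) := by
  obtain ⟨hd, C, hC⟩ := hf
  have h := norm_le_interp_of_mem_verticalClosedStrip' (f := f) (z := t) (l := 0) (u := e) he
    (by simp [verticalClosedStrip, ht, hte]) hd.diffContOnCl
    ⟨C, by rintro _ ⟨z, hz, rfl⟩; exact hC z hz.1 (hz.2.trans he1)⟩ ha hb
  simpa using h

lemma hasDerivWithinAt_Ici_of_squeeze {f g l : ℝ → ℝ} {c a : ℝ} (hl : HasDerivAt l c a)
    (hg : HasDerivAt g c a) (hla : l a = g a) (hlf : ∀ t, a ≤ t → l t ≤ f t)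
    (hfg : ∀ t, a ≤ t → f t ≤ g t) : HasDerivWithinAt f c (Set.Ici a) a := by
  have hfa : f a = l a := le_antisymm ((hfg a le_rfl).trans hla.ge) (hlf a le_rfl)
  rw [← hasDerivWithinAt_Ioi_iff_Ici, hasDerivWithinAt_iff_tendsto_slope' Set.self_notMem_Ioi]
  have hl' := (hasDerivWithinAt_iff_tendsto_slope' Set.self_notMem_Ioi).1
    (hl.hasDerivWithinAt (s := Set.Ioi a))
  have hg' := (hasDerivWithinAt_iff_tendsto_slope' Set.self_notMem_Ioi).1
    (hg.hasDerivWithinAt (s := Set.Ioi a))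
  refine tendsto_of_tendsto_of_tendsto_of_le_of_le' hl' hg' ?_ ?_
  · filter_upwards [self_mem_nhdsWithin] with t (ht : a < t)
    rw [slope_def_field, slope_def_field, hfa]
    exact div_le_div_of_nonneg_right (sub_le_sub_right (hlf t ht.le) _) (sub_nonneg.2 ht.le)
  · filter_upwards [self_mem_nhdsWithin] with t (ht : a < t)
    rw [slope_def_field, slope_def_field, hfa, hla]
    exact div_le_div_of_nonneg_right (sub_le_sub_right (hfg t ht.le) _) (sub_nonneg.2 ht.le)

lemma hasDerivAt_le_of_eventually_le {f g : ℝ → ℝ} {f' g' a : ℝ} (hf : HasDerivAt f f' a)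
    (hg : HasDerivAt g g' a) (h_eq : f a = g a) (h_le : ∀ᶠ t in 𝓝[>] 0, f (a + t) ≤ g (a + t)) :
    f' ≤ g' := by
  refine le_of_tendsto_of_tendsto hf.tendsto_slope_zero_right hg.tendsto_slope_zero_right ?_
  filter_upwards [h_le, self_mem_nhdsWithin] with t ht (ht0 : 0 < t)
  rw [h_eq, smul_eq_mul, smul_eq_mul]
  gcongr

/-- The three lines theorem at its endpoint: compare derivatives at `0` in `f t ≤ b ^ (t / e)`. -/
lemma StripBounded.exp_mul_re_deriv_le {f : ℂ → ℂ} (hf : StripBounded f) {f' : ℂ} {e b : ℝ}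
    (he : 0 < e) (he1 : e ≤ 1) (hf0 : f 0 = 1) (hf' : HasDerivAt f f' 0)
    (hleft : ∀ z : ℂ, z.re = 0 → ‖f z‖ ≤ 1) (hright : ∀ z : ℂ, z.re = e → ‖f z‖ ≤ b) :
    Real.exp (e * f'.re) ≤ b := by
  refine le_of_forall_gt_imp_ge_of_dense fun c hbc => ?_
  have hc : 0 < c := (norm_nonneg (f e)).trans_lt ((hright e (Complex.ofReal_re e)).trans_lt hbc)
  have hdiv : HasDerivAt (fun t : ℝ => t / e) (1 / e) 0 := (hasDerivAt_id 0).div_const e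
  have hpow : HasDerivAt (fun t : ℝ => c ^ (t / e)) (Real.log c / e) 0 := by
    simpa [div_eq_mul_inv] using hdiv.const_rpow hc
  have hle : f'.re ≤ Real.log c / e := by
    refine hasDerivAt_le_of_eventually_le (HasDerivAt.real_of_complex hf') hpow (by simp [hf0]) ?_
    filter_upwards [Ioo_mem_nhdsGT he] with t ht
    have h := hf.norm_le_rpow_mul_rpow he he1 hleft (fun z hz => (hright z hz).trans hbc.le)
      ht.1.le ht.2.le
    rw [zero_add]
    simpa using (Complex.re_le_norm _).trans h
  rw [← Real.le_log_iff_exp_le hc, mul_comm]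
  exact (le_div_iff₀ he).1 hle

variable {ι : Type*} [Fintype ι]

lemma hasDerivAt_trace {M : ℂ → Matrix ι ι ℂ} {M' : Matrix ι ι ℂ} {z : ℂ}
    (hM : HasDerivAt M M' z) : HasDerivAt (fun z => (M z).trace) M'.trace z := by
  classical
  exact (traceLinearMap ι ℂ ℂ).toContinuousLinearMap.hasFDerivAt.comp_hasDerivAt z hM

variable [DecidableEq ι]

lemma hasDerivAt_udv (U V : unitaryGroup ι ℂ) {d : ℂ → ι → ℂ} {d' : ι → ℂ} {z : ℂ}
    (hd : ∀ i, HasDerivAt (fun w => d w i) (d' i) z) :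
    HasDerivAt (fun w => udv U V (d w)) (udv U V d') z := by
  have h := (diagonalLinearMap ι ℂ ℂ).toContinuousLinearMap.hasFDerivAt.comp_hasDerivAt z
    (hasDerivAt_pi.2 hd)
  exact (h.const_mul U.1).mul_const (star V.1)

lemma hasDerivAt_svdPow (U V : unitaryGroup ι ℂ) (s : ι → ℝ≥0) (z : ℂ) :
    HasDerivAt (svdPow U V s) (svdLog U s * svdPow U V s z) z := by
  rw [svdLog, svdPow, udv_mul_udv]
  exact hasDerivAt_udv U V fun i => hasDerivAt_suppPow (s i) z

lemma norm_svdPow_ofReal_re (U V : unitaryGroup ι ℂ) (s : ι → ℝ≥0) (z : ℂ) :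
    ‖svdPow U V s z.re‖ = ‖svdPow U V s z‖ := by
  rw [svdPow, svdPow, norm_udv, norm_udv, Pi.norm_def, Pi.norm_def]
  exact congr_arg _ (Finset.sup_congr rfl fun i _ => NNReal.eq (norm_suppPow_ofReal_re (s i) z))

lemma stripBounded_svdPow (U V : unitaryGroup ι ℂ) (s : ι → ℝ≥0) (a b : ℝ) :
    StripBounded fun z => svdPow U V s (a * z + b) := by
  have hdiff : Differentiable ℂ fun z => svdPow U V s (a * z + b) :=
    fun z => (hasDerivAt_svdPow U V s _).differentiableAt.comp z (by fun_prop)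
  obtain ⟨C, hC⟩ := (isCompact_Icc (a := (0 : ℝ)) (b := 1)).exists_bound_of_continuousOn
    (hdiff.continuous.comp Complex.continuous_ofReal).continuousOn
  refine ⟨hdiff, C, fun z h0 h1 => ?_⟩
  rw [← norm_svdPow_ofReal_re]
  simpa using hC z.re ⟨h0, h1⟩

lemma StripBounded.trace {M : ℂ → Matrix ι ι ℂ} (hM : StripBounded M) :
    StripBounded fun z => (M z).trace :=
  hM.clm_comp (traceLinearMap ι ℂ ℂ).toContinuousLinearMap

lemma StripBounded.amp {m n : ℕ} {M : ℂ → Matrix (Fin m) (Fin m) ℂ} (hM : StripBounded M) :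
    StripBounded fun z => amp m n (M z) :=
  hM.clm_comp (OperatorSpaceEntropy.amp m n).toAlgHom.toLinearMap.toContinuousLinearMap

lemma hasDerivAt_amp {m n : ℕ} {M : ℂ → Matrix (Fin m) (Fin m) ℂ} {M' : Matrix (Fin m) (Fin m) ℂ}
    {z : ℂ} (hM : HasDerivAt M M' z) : HasDerivAt (fun z => amp m n (M z)) (amp m n M') z :=
  (amp m n).toAlgHom.toLinearMap.toContinuousLinearMap.hasFDerivAt.comp_hasDerivAt z hM

lemma schattenNorm_le_rpow_of_stripBounded {M : ℂ → Matrix ι ι ℂ} (hM : StripBounded M) {p C : ℝ}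
    (hp : 1 ≤ p) (hleft : ∀ z : ℂ, z.re = 0 → ‖M z‖ ≤ 1)
    (hright : ∀ z : ℂ, z.re = 1 → schattenNorm 1 (M z) ≤ C) :
    schattenNorm p (M (1 / p : ℝ)) ≤ C ^ (1 / p) := by
  have hp0 : 0 < p := zero_lt_one.trans_le hp
  have hC : 0 ≤ C := (schattenNorm_nonneg 1 _).trans (hright 1 rfl)
  obtain ⟨S, T, s, hs⟩ := exists_eq_svdPow (M (1 / p : ℝ))
  set N := ∑ i, (s i : ℝ) ^ p with hN_def
  rw [hs, schattenNorm_svdPow_one, ← hN_def]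
  obtain hN | hN := (show 0 ≤ N by positivity).eq_or_lt
  · rw [← hN, Real.zero_rpow (one_div_pos.2 hp0).ne']
    positivity
  -- The dual interpolating family, normalised so that the pairing at `1 / p` is `N`.
  set G : ℂ → Matrix ι ι ℂ := fun z => svdPow T S s ((-p : ℝ) * z + p)
  have hre (z : ℂ) : ((-p : ℝ) * z + p : ℂ).re = p * (1 - z.re) := by
    simp
    ring
  have pairing_left (z : ℂ) (hz : z.re = 0) : ‖(M z * G z).trace‖ ≤ N := by
    have hG : schattenNorm 1 (G z) = N := by
      rw [schattenNorm_svdPow _ _ _ _ (by rw [hre, hz]; simpa using hp0.ne'), hre, hz]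
      simp [N]
    rw [trace_mul_comm]
    refine (norm_trace_mul_le_schattenNorm_one_mul_norm _ _).trans ?_
    rw [hG]
    exact mul_le_of_le_one_right hN.le (hleft z hz)
  have pairing_right (z : ℂ) (hz : z.re = 1) : ‖(M z * G z).trace‖ ≤ C := by
    refine (norm_trace_mul_le_schattenNorm_one_mul_norm _ _).trans ?_
    have hG : ‖G z‖ ≤ 1 := norm_svdPow_le_one _ _ _ (by rw [hre, hz]; simp)
    simpa using mul_le_mul (hright z hz) hG (norm_nonneg _) hC
  have pairing : (M (1 / p : ℝ) * G (1 / p : ℝ)).trace = N := by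
    have hexp : (1 + ((-p : ℝ) * (1 / p : ℝ) + p) : ℂ) = (p : ℝ) := by
      push_cast
      field_simp
      ring
    rw [hs, svdPow_mul_svdPow, hexp, trace_svdPow_ofReal _ _ hp0.ne']
  have h := ((hM.mul (stripBounded_svdPow T S s (-p) p)).trace).norm_le_rpow_mul_rpow one_pos le_rfl
    pairing_left pairing_right (one_div_pos.2 hp0).le ((div_le_one hp0).2 hp)
  rw [pairing, Complex.norm_real, Real.norm_of_nonneg hN.le, div_one, Real.rpow_sub hN,
    Real.rpow_one, div_mul_eq_mul_div, mul_div_assoc, le_mul_iff_one_le_right hN,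
    one_le_div (by positivity)] at h
  exact h

end StripBounded

section OperatorSpaceNorms

variable {m n : ℕ} {t p : ℝ} {X Z : Matrix (Fin m × Fin n) (Fin m × Fin n) ℂ}

lemma schattenNorm_amp_mul_mul_amp_le (hp : 0 < p)
    (Z : Matrix (Fin m × Fin n) (Fin m × Fin n) ℂ) (A B : Matrix (Fin m) (Fin m) ℂ) :
    schattenNorm p (amp m n A * Z * amp m n B)
      ≤ (Fintype.card (Fin m × Fin n) : ℝ) ^ (1 / p) * ‖Z‖
        * (schattenNorm (2 * p) A * schattenNorm (2 * p) B) := by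
  have norm_le (C : Matrix (Fin m) (Fin m) ℂ) : ‖amp m n C‖ ≤ schattenNorm (2 * p) C :=
    (norm_amp_le C).trans (norm_le_schattenNorm (by positivity) C)
  have hA := schattenNorm_nonneg (2 * p) A
  calc schattenNorm p (amp m n A * Z * amp m n B)
      ≤ (Fintype.card (Fin m × Fin n) : ℝ) ^ (1 / p) * ‖amp m n A * Z * amp m n B‖ :=
        schattenNorm_le_card_rpow_mul_norm hp _
    _ ≤ (Fintype.card (Fin m × Fin n) : ℝ) ^ (1 / p)
          * (schattenNorm (2 * p) A * ‖Z‖ * schattenNorm (2 * p) B) := by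
        gcongr
        exact (norm_mul₃_le).trans (by gcongr <;> exact norm_le _)
    _ = _ := by ring

lemma normInfty_nonneg (p : ℝ) (Z : Matrix (Fin m × Fin n) (Fin m × Fin n) ℂ) :
    0 ≤ normInfty p Z := by
  refine Real.sSup_nonneg ?_
  rintro _ ⟨A, B, -, -, rfl⟩
  exact div_nonneg (schattenNorm_nonneg _ _)
    (mul_nonneg (schattenNorm_nonneg _ _) (schattenNorm_nonneg _ _))

lemma normInfty_le {c : ℝ} (hc : 0 ≤ c)
    (h : ∀ A B : Matrix (Fin m) (Fin m) ℂ, schattenNorm p (amp m n A * Z * amp m n B)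
      ≤ c * (schattenNorm (2 * p) A * schattenNorm (2 * p) B)) : normInfty p Z ≤ c := by
  refine Real.sSup_le ?_ hc
  rintro _ ⟨A, B, -, -, rfl⟩
  exact div_le_of_le_mul₀ (mul_nonneg (schattenNorm_nonneg _ _) (schattenNorm_nonneg _ _)) hc
    (h A B)

lemma schattenNorm_amp_mul_mul_amp_le_normInfty (hp : 0 < p)
    (Z : Matrix (Fin m × Fin n) (Fin m × Fin n) ℂ) (A B : Matrix (Fin m) (Fin m) ℂ) :
    schattenNorm p (amp m n A * Z * amp m n B)
      ≤ normInfty p Z * (schattenNorm (2 * p) A * schattenNorm (2 * p) B) := by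
  have prod_nonneg (A B : Matrix (Fin m) (Fin m) ℂ) :
      0 ≤ schattenNorm (2 * p) A * schattenNorm (2 * p) B :=
    mul_nonneg (schattenNorm_nonneg _ _) (schattenNorm_nonneg _ _)
  obtain h | h := (prod_nonneg A B).eq_or_lt
  · rw [← h, mul_zero]
    simpa [← h] using schattenNorm_amp_mul_mul_amp_le hp Z A B
  have ne_zero {C : Matrix (Fin m) (Fin m) ℂ} (hC : schattenNorm (2 * p) C ≠ 0) : C ≠ 0 := by
    rintro rfl
    exact hC (schattenNorm_zero (by positivity))
  rw [← div_le_iff₀ h]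
  refine le_csSup ⟨(Fintype.card (Fin m × Fin n) : ℝ) ^ (1 / p) * ‖Z‖, ?_⟩
    ⟨A, B, ne_zero (left_ne_zero_of_mul h.ne'), ne_zero (right_ne_zero_of_mul h.ne'), rfl⟩
  rintro _ ⟨A', B', -, -, rfl⟩
  exact div_le_of_le_mul₀ (prod_nonneg A' B') (by positivity)
    (schattenNorm_amp_mul_mul_amp_le hp Z A' B')

lemma factorizationNorm_nonneg (t p : ℝ) (A B : Matrix (Fin m) (Fin m) ℂ)
    (Z : Matrix (Fin m × Fin n) (Fin m × Fin n) ℂ) :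
    0 ≤ schattenNorm (2 * t) A * schattenNorm (2 * t) B * normInfty p Z :=
  mul_nonneg (mul_nonneg (schattenNorm_nonneg _ _) (schattenNorm_nonneg _ _)) (normInfty_nonneg _ _)

lemma normLtLp_nonneg (t p : ℝ) (X : Matrix (Fin m × Fin n) (Fin m × Fin n) ℂ) :
    0 ≤ normLtLp t p X := by
  refine Real.sInf_nonneg ?_
  rintro _ ⟨A, B, Z, -, rfl⟩
  exact factorizationNorm_nonneg t p A B Z

lemma normLtLp_le {A B : Matrix (Fin m) (Fin m) ℂ} (h : X = amp m n A * Z * amp m n B) :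
    normLtLp t p X ≤ schattenNorm (2 * t) A * schattenNorm (2 * t) B * normInfty p Z := by
  refine csInf_le ⟨0, ?_⟩ ⟨A, B, Z, h, rfl⟩
  rintro _ ⟨A, B, Z, -, rfl⟩
  exact factorizationNorm_nonneg t p A B Z

lemma le_normLtLp {c : ℝ} (h : ∀ (A B : Matrix (Fin m) (Fin m) ℂ)
      (Z : Matrix (Fin m × Fin n) (Fin m × Fin n) ℂ), X = amp m n A * Z * amp m n B →
        c ≤ schattenNorm (2 * t) A * schattenNorm (2 * t) B * normInfty p Z) :
    c ≤ normLtLp t p X := by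
  refine le_csInf ⟨_, 1, 1, X, by simp, rfl⟩ ?_
  rintro _ ⟨A, B, Z, hX, rfl⟩
  exact h A B Z hX

lemma schattenNorm_le_normLtLp (hp : 0 < p) (X : Matrix (Fin m × Fin n) (Fin m × Fin n) ℂ) :
    schattenNorm p X ≤ normLtLp p p X :=
  le_normLtLp fun A B Z h => by
    rw [h, mul_comm _ (normInfty p Z)]
    exact schattenNorm_amp_mul_mul_amp_le_normInfty hp Z A B

end OperatorSpaceNorms

section LowerBound

variable {m n : ℕ} {p q : ℝ}

lemma trace_svdLog_mul_svdPow_one {ι : Type*} [Fintype ι] [DecidableEq ι] (U : unitaryGroup ι ℂ)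
    (x : ι → ℝ≥0) : (svdLog U x * svdPow U U x 1).trace.re = -vnEntropy (svdPow U U x 1) := by
  rw [vnEntropy_svdPow_one, neg_neg, svdPow_one, svdLog, udv_mul_udv, trace_udv_self]
  simp [mul_comm]

lemma schattenNorm_two_mul_svdPow {ι : Type*} [Fintype ι] [DecidableEq ι] (hp : 0 < p)
    (U V : unitaryGroup ι ℂ) (s : ι → ℝ≥0) {z : ℂ} (hz : z.re = p⁻¹) :
    schattenNorm (2 * p) (svdPow U V s z) = schattenNorm 2 (svdPow U V s 1) ^ p⁻¹ := by
  have hexp : p⁻¹ * (2 * p) = 2 := by field_simp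
  rw [schattenNorm_svdPow _ _ _ _ (hz ▸ inv_ne_zero hp.ne'), schattenNorm_svdPow_one, hz, hexp,
    ← Real.rpow_mul (by positivity)]
  congr 1
  field_simp

lemma trace_amp_svdLog_mul_le {X Y : Matrix (Fin m × Fin n) (Fin m × Fin n) ℂ}
    (hX : X.PosSemidef) (hX_trace : X.trace = 1) {S T : unitaryGroup (Fin m) ℂ} {a : Fin m → ℝ≥0}
    (h : X = amp m n (svdPow S T a 1) * Y) :
    (amp m n (svdLog S a) * X).trace.re
      ≤ -vnEntropy (partialTrace₂ X) / 2 + Real.log (schattenNorm 2 (svdPow S T a 1)) := by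
  have hsupp : svdPow S S (fun i => a i ^ 2) 0 * partialTrace₂ X = partialTrace₂ X := by
    have hsq : svdPow S S (fun i => a i ^ 2) 0 = svdPow S S a 0 := by simp [svdPow, suppPow]
    rw [hsq, ← partialTrace₂_amp_mul, h, ← Matrix.mul_assoc, ← map_mul, svdPow_mul_svdPow, zero_add]
  have hlog : svdLog S (fun i => a i ^ 2) = svdLog S a + svdLog S a := by
    have hdiag : (fun i => (Real.log ((a i ^ 2 : ℝ≥0) : ℝ) : ℂ))
        = (fun i => (Real.log (a i) : ℂ)) + fun i => (Real.log (a i) : ℂ) := by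
      ext i
      simp [two_mul]
    rw [svdLog, hdiag, svdLog, udv, udv, ← Matrix.add_mul, ← Matrix.mul_add, diagonal_add]
    rfl
  have klein := trace_log_mul_le (posSemidef_partialTrace₂ hX)
    ((trace_partialTrace₂ X).trans hX_trace) hsupp
  rw [hlog, Matrix.add_mul, trace_add, Complex.add_re] at klein
  have hnorm : Real.log (schattenNorm 2 (svdPow S T a 1))
      = Real.log (∑ i, ((a i ^ 2 : ℝ≥0) : ℝ)) / 2 := by
    rw [schattenNorm_svdPow_one, ← Real.sqrt_eq_rpow, Real.log_sqrt (by positivity)]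
    simp
  rw [trace_amp_mul, hnorm]
  linarith

lemma trace_mul_amp_svdLog_le {X Y : Matrix (Fin m × Fin n) (Fin m × Fin n) ℂ}
    (hX : X.PosSemidef) (hX_trace : X.trace = 1) {S T : unitaryGroup (Fin m) ℂ} {a : Fin m → ℝ≥0}
    (h : X = Y * amp m n (svdPow S T a 1)) :
    (amp m n (svdLog T a) * X).trace.re
      ≤ -vnEntropy (partialTrace₂ X) / 2 + Real.log (schattenNorm 2 (svdPow S T a 1)) := by
  rw [← schattenNorm_conjTranspose, conjTranspose_svdPow, star_one]
  refine trace_amp_svdLog_mul_le (Y := Yᴴ) hX hX_trace ?_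
  rw [← hX.1, h, conjTranspose_mul, ← amp_conjTranspose, conjTranspose_svdPow, star_one]

/-- The function `z ↦ Tr (A^{1-z} ⊗ I) Z (B^{1-z} ⊗ I) X^z`, where the powers of
`A = S diag(a) T*` and `B = U diag(b) V*` act on singular values and `X = W diag(x) W*`. When
`X = (A ⊗ I) Z (B ⊗ I)` it interpolates between `‖X‖_1` and the norms of the factorization. -/
def factorInterpolant (S T U V : unitaryGroup (Fin m) ℂ) (a b : Fin m → ℝ≥0)
    (Z : Matrix (Fin m × Fin n) (Fin m × Fin n) ℂ) (W : unitaryGroup (Fin m × Fin n) ℂ)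
    (x : Fin m × Fin n → ℝ≥0) (z : ℂ) : ℂ :=
  (amp m n (svdPow S T a (1 - z)) * Z * amp m n (svdPow U V b (1 - z)) * svdPow W W x z).trace

lemma stripBounded_factorInterpolant (S T U V : unitaryGroup (Fin m) ℂ) (a b : Fin m → ℝ≥0)
    (Z : Matrix (Fin m × Fin n) (Fin m × Fin n) ℂ) (W : unitaryGroup (Fin m × Fin n) ℂ)
    (x : Fin m × Fin n → ℝ≥0) : StripBounded (factorInterpolant S T U V a b Z W x) := by
  have h := ((((stripBounded_svdPow S T a (-1) 1).amp.mul (.const Z)).mul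
    (stripBounded_svdPow U V b (-1) 1).amp).mul (stripBounded_svdPow W W x 1 0)).trace
  unfold factorInterpolant
  simpa [neg_add_eq_sub] using h

variable {S T U V : unitaryGroup (Fin m) ℂ} {a b : Fin m → ℝ≥0}
  {Z : Matrix (Fin m × Fin n) (Fin m × Fin n) ℂ} {W : unitaryGroup (Fin m × Fin n) ℂ}
  {x : Fin m × Fin n → ℝ≥0}

lemma factorInterpolant_zero
    (h : svdPow W W x 1 = amp m n (svdPow S T a 1) * Z * amp m n (svdPow U V b 1)) :
    factorInterpolant S T U V a b Z W x 0 = (svdPow W W x 1).trace := by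
  rw [factorInterpolant, sub_zero, ← h, svdPow_mul_svdPow, add_zero]

lemma hasDerivAt_factorInterpolant
    (h : svdPow W W x 1 = amp m n (svdPow S T a 1) * Z * amp m n (svdPow U V b 1)) :
    HasDerivAt (factorInterpolant S T U V a b Z W x)
      ((svdLog W x * svdPow W W x 1).trace - (amp m n (svdLog S a) * svdPow W W x 1).trace
        - (amp m n (svdLog V b) * svdPow W W x 1).trace) 0 := by
  have hpow (S T : unitaryGroup (Fin m) ℂ) (a : Fin m → ℝ≥0) :
      HasDerivAt (fun z => amp m n (svdPow S T a (1 - z)))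
        (-amp m n (svdLog S a * svdPow S T a 1)) 0 := by
    have hinner : HasDerivAt (fun z : ℂ => 1 - z) (-1) 0 := (hasDerivAt_id 0).const_sub 1
    have houter := hasDerivAt_svdPow S T a (1 - 0)
    simpa using hasDerivAt_amp (houter.scomp 0 hinner)
  have hF := hasDerivAt_trace ((((hpow S T a).mul_const Z).mul (hpow U V b)).mul
    (hasDerivAt_svdPow W W x 0))
  have hX (K : Matrix (Fin m × Fin n) (Fin m × Fin n) ℂ) :
      amp m n (svdPow S T a 1) * (Z * (amp m n (svdPow U V b 1) * K)) = svdPow W W x 1 * K := by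
    rw [h]
    simp only [Matrix.mul_assoc]
  have hcyclic (K : Matrix (Fin m × Fin n) (Fin m × Fin n) ℂ) :
      (svdPow W W x 1 * (K * svdPow W W x 0)).trace = (K * svdPow W W x 1).trace := by
    rw [trace_mul_comm, Matrix.mul_assoc, svdPow_mul_svdPow, zero_add]
  refine hF.congr_deriv ?_
  rw [← svdPow_mul_svdLog U V b]
  simp only [Pi.mul_apply, sub_zero, map_mul, Matrix.mul_assoc, Matrix.neg_mul, Matrix.mul_neg,
    Matrix.add_mul, trace_add, trace_neg, hX, hcyclic]
  rw [svdPow_mul_svdPow, add_zero]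
  ring

lemma entropy_sub_log_le_re_deriv_factorInterpolant (hx : (svdPow W W x 1).trace = 1)
    (ha : 0 < schattenNorm 2 (svdPow S T a 1)) (hb : 0 < schattenNorm 2 (svdPow U V b 1))
    (h : svdPow W W x 1 = amp m n (svdPow S T a 1) * Z * amp m n (svdPow U V b 1)) :
    -vnEntropy (svdPow W W x 1) + vnEntropy (partialTrace₂ (svdPow W W x 1))
        - Real.log (schattenNorm 2 (svdPow S T a 1) * schattenNorm 2 (svdPow U V b 1))
      ≤ ((svdLog W x * svdPow W W x 1).trace - (amp m n (svdLog S a) * svdPow W W x 1).trace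
        - (amp m n (svdLog V b) * svdPow W W x 1).trace).re := by
  have log_left := trace_amp_svdLog_mul_le (posSemidef_svdPow_one W x) hx
    (h.trans (Matrix.mul_assoc _ _ _))
  have log_right := trace_mul_amp_svdLog_le (posSemidef_svdPow_one W x) hx h
  rw [Complex.sub_re, Complex.sub_re, trace_svdLog_mul_svdPow_one, Real.log_mul ha.ne' hb.ne']
  linarith

lemma norm_factorInterpolant_le_of_re_eq_zero
    (h : svdPow W W x 1 = amp m n (svdPow S T a 1) * Z * amp m n (svdPow U V b 1)) {z : ℂ}
    (hz : z.re = 0) :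
    ‖factorInterpolant S T U V a b Z W x z‖ ≤ schattenNorm 1 (svdPow W W x 1) := by
  set K := amp m n (svdPow V V b (-z)) * svdPow W W x z * amp m n (svdPow S S a (-z))
  have hF : factorInterpolant S T U V a b Z W x z = (svdPow W W x 1 * K).trace := by
    have hA : svdPow S T a (1 - z) = svdPow S S a (-z) * svdPow S T a 1 := by
      rw [svdPow_mul_svdPow, neg_add_eq_sub]
    have hB : svdPow U V b (1 - z) = svdPow U V b 1 * svdPow V V b (-z) := by
      rw [svdPow_mul_svdPow, sub_eq_add_neg]
    simp only [K]
    rw [factorInterpolant, hA, hB, map_mul, map_mul, ← Matrix.mul_assoc (svdPow W W x 1),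
      trace_mul_comm _ (amp m n (svdPow S S a (-z))), h]
    simp only [Matrix.mul_assoc]
  have amp_le_one (V : unitaryGroup (Fin m) ℂ) (b : Fin m → ℝ≥0) :
      ‖amp m n (svdPow V V b (-z))‖ ≤ 1 :=
    (norm_amp_le _).trans (norm_svdPow_le_one V V b (by simp [hz]))
  have hK : ‖K‖ ≤ 1 := by
    refine norm_mul₃_le.trans ?_
    exact mul_le_one₀ (mul_le_one₀ (amp_le_one V b) (norm_nonneg _) (norm_svdPow_le_one W W x hz))
      (norm_nonneg _) (amp_le_one S a)
  rw [hF]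
  exact (norm_trace_mul_le_schattenNorm_one_mul_norm _ _).trans
    (mul_le_of_le_one_right (schattenNorm_nonneg _ _) hK)

lemma norm_factorInterpolant_le_of_re_eq_inv (hpq : p.HolderConjugate q) {z : ℂ}
    (hz : z.re = q⁻¹) :
    ‖factorInterpolant S T U V a b Z W x z‖ ≤ normInfty p Z
      * (schattenNorm 2 (svdPow S T a 1) * schattenNorm 2 (svdPow U V b 1)) ^ p⁻¹
      * schattenNorm 1 (svdPow W W x 1) ^ q⁻¹ := by
  have hre : (1 - z).re = p⁻¹ := by
    rw [Complex.sub_re, Complex.one_re, hz, hpq.symm.one_sub_inv]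
  have hXz : schattenNorm q (svdPow W W x z) = schattenNorm 1 (svdPow W W x 1) ^ q⁻¹ := by
    rw [schattenNorm_svdPow _ _ _ _ (hz ▸ hpq.symm.inv_ne_zero), schattenNorm_svdPow_one, hz,
      inv_mul_cancel₀ hpq.symm.ne_zero, one_div, one_div_one, Real.rpow_one]
  rw [← hXz, Real.mul_rpow (schattenNorm_nonneg _ _) (schattenNorm_nonneg _ _),
    ← schattenNorm_two_mul_svdPow hpq.pos S T a hre,
    ← schattenNorm_two_mul_svdPow hpq.pos U V b hre]
  refine (norm_trace_mul_le hpq _ _).trans ?_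
  exact mul_le_mul_of_nonneg_right (schattenNorm_amp_mul_mul_amp_le_normInfty hpq.pos Z _ _)
    (schattenNorm_nonneg _ _)

lemma exp_le_of_factorization (hpq : p.HolderConjugate q)
    {X : Matrix (Fin m × Fin n) (Fin m × Fin n) ℂ} (hX : X.PosSemidef) (hX_trace : X.trace = 1)
    {A B : Matrix (Fin m) (Fin m) ℂ} (h : X = amp m n A * Z * amp m n B) :
    Real.exp (q⁻¹ * (-vnEntropy X + vnEntropy (partialTrace₂ X)))
      ≤ schattenNorm 2 A * schattenNorm 2 B * normInfty p Z := by
  have hX_ne : X ≠ 0 := by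
    rintro rfl
    simp at hX_trace
  have hα : 0 < schattenNorm 2 A := schattenNorm_pos two_pos (by rintro rfl; simp [h] at hX_ne)
  have hβ : 0 < schattenNorm 2 B := schattenNorm_pos two_pos (by rintro rfl; simp [h] at hX_ne)
  have hX_norm : schattenNorm 1 X = 1 := by
    rw [schattenNorm_one_of_posSemidef hX, hX_trace, Complex.one_re]
  obtain ⟨W, x, rfl⟩ := exists_eq_svdPow_of_posSemidef hX
  obtain ⟨S, T, a, rfl⟩ := exists_eq_svdPow A
  obtain ⟨U, V, b, rfl⟩ := exists_eq_svdPow B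
  set X := svdPow W W x 1
  set α := schattenNorm 2 (svdPow S T a 1)
  set β := schattenNorm 2 (svdPow U V b 1)
  have three_lines := (stripBounded_factorInterpolant S T U V a b Z W x).exp_mul_re_deriv_le
    hpq.symm.inv_pos (inv_le_one_of_one_le₀ hpq.symm.lt.le)
    ((factorInterpolant_zero h).trans hX_trace) (hasDerivAt_factorInterpolant h)
    (fun z hz => (norm_factorInterpolant_le_of_re_eq_zero h hz).trans_eq hX_norm)
    (fun z hz => norm_factorInterpolant_le_of_re_eq_inv hpq hz)
  rw [hX_norm, Real.one_rpow, mul_one] at three_lines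
  have := mul_pos hα hβ
  calc Real.exp (q⁻¹ * (-vnEntropy X + vnEntropy (partialTrace₂ X)))
      = Real.exp (q⁻¹ * (-vnEntropy X + vnEntropy (partialTrace₂ X) - Real.log (α * β)))
          * (α * β) ^ q⁻¹ := by
        rw [Real.rpow_def_of_pos this, ← Real.exp_add]
        ring_nf
    _ ≤ normInfty p Z * (α * β) ^ p⁻¹ * (α * β) ^ q⁻¹ := by
        gcongr
        refine (Real.exp_le_exp.2 ?_).trans three_lines
        exact mul_le_mul_of_nonneg_left
          (entropy_sub_log_le_re_deriv_factorInterpolant hX_trace hα hβ h) hpq.symm.inv_nonneg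
    _ = α * β * normInfty p Z := by
        rw [mul_assoc, ← Real.rpow_add this, hpq.inv_add_inv_eq_one, Real.rpow_one, mul_comm]

lemma exp_le_normLtLp_one_rpow {X : Matrix (Fin m × Fin n) (Fin m × Fin n) ℂ} (hX : X.PosSemidef)
    (hX_trace : X.trace = 1) (hp : 1 ≤ p) :
    Real.exp ((p - 1) * (-vnEntropy X + vnEntropy (partialTrace₂ X))) ≤ normLtLp 1 p X ^ p := by
  obtain rfl | hp := hp.eq_or_lt
  · simpa [schattenNorm_one_of_posSemidef hX, hX_trace] using
      schattenNorm_le_normLtLp zero_lt_one X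
  have hpq := Real.HolderConjugate.conjExponent hp
  have h : Real.exp (p.conjExponent⁻¹ * (-vnEntropy X + vnEntropy (partialTrace₂ X)))
      ≤ normLtLp 1 p X :=
    le_normLtLp fun A B Z h => by
      simpa only [mul_one] using exp_le_of_factorization hpq hX hX_trace h
  have hexp : p.conjExponent⁻¹ * p = p - 1 := by
    rw [← hpq.one_sub_inv, sub_mul, inv_mul_cancel₀ hpq.ne_zero, one_mul]
  calc _ = Real.exp (p.conjExponent⁻¹ * (-vnEntropy X + vnEntropy (partialTrace₂ X))) ^ p := by
        rw [← Real.exp_mul, mul_right_comm, hexp]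
    _ ≤ normLtLp 1 p X ^ p := Real.rpow_le_rpow (Real.exp_nonneg _) h hpq.nonneg

end LowerBound

section UpperBound

variable {m n : ℕ} {p : ℝ} {S T V : unitaryGroup (Fin m) ℂ} {a y : Fin m → ℝ≥0}
  {U : unitaryGroup (Fin m × Fin n) ℂ} {x : Fin m × Fin n → ℝ≥0}

/-- The function `z ↦ (A^{pz} P^{-z/2} ⊗ I) X^{pz/2}`, where `A = S diag(a) T*`, `P = V diag(y) V*`
and `X = U diag(x) U*`. If `P = Tr₂ X^p`, it is contractive on the imaginary axis in operator norm
and bounded by `‖A‖_{2p}^p` on the line `re z = 1` in the norm `‖·‖₂`. -/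
def marginalInterpolant (p : ℝ) (S T V : unitaryGroup (Fin m) ℂ) (a y : Fin m → ℝ≥0)
    (U : unitaryGroup (Fin m × Fin n) ℂ) (x : Fin m × Fin n → ℝ≥0) (z : ℂ) :
    Matrix (Fin m × Fin n) (Fin m × Fin n) ℂ :=
  amp m n (svdPow S T a (p * z) * svdPow V V y (-z / 2)) * svdPow U U x (p * z / 2)

lemma conjTranspose_marginalInterpolant_star (z : ℂ) :
    (marginalInterpolant p S T V a y U x (star z))ᴴ
      = svdPow U U x (p * z / 2) * amp m n (svdPow V V y (-z / 2) * svdPow T S a (p * z)) := by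
  rw [marginalInterpolant, conjTranspose_mul, ← amp_conjTranspose, conjTranspose_mul,
    conjTranspose_svdPow, conjTranspose_svdPow, conjTranspose_svdPow]
  simp

variable (p S T V a y U x) in
lemma stripBounded_marginalInterpolant :
    StripBounded (marginalInterpolant p S T V a y U x) := by
  have h := ((stripBounded_svdPow S T a p 0).mul (stripBounded_svdPow V V y (-1 / 2) 0)).amp.mul
    (stripBounded_svdPow U U x (p / 2) 0)
  unfold marginalInterpolant
  simpa [div_mul_eq_mul_div] using h

variable (p S T V a y U x) in
lemma stripBounded_conjTranspose_marginalInterpolant_star :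
    StripBounded fun z => (marginalInterpolant p S T V a y U x (star z))ᴴ := by
  have h := (stripBounded_svdPow U U x (p / 2) 0).mul
    ((stripBounded_svdPow V V y (-1 / 2) 0).mul (stripBounded_svdPow T S a p 0)).amp
  simp only [conjTranspose_marginalInterpolant_star]
  simpa [div_mul_eq_mul_div] using h

lemma norm_marginalInterpolant_le_one {z : ℂ} (hz : z.re = 0) :
    ‖marginalInterpolant p S T V a y U x z‖ ≤ 1 := by
  have hA := norm_svdPow_le_one S T a (z := p * z) (by simp [hz])
  have hP := norm_svdPow_le_one V V y (z := -z / 2) (by simp [hz])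
  have hX := norm_svdPow_le_one U U x (z := p * z / 2) (by simp [hz])
  refine (norm_mul_le _ _).trans (mul_le_one₀ ((norm_amp_le _).trans ?_) (norm_nonneg _) hX)
  exact (norm_mul_le _ _).trans (mul_le_one₀ hA (norm_nonneg _) hP)

lemma schattenNorm_two_marginalInterpolant_le (hp : 0 < p)
    (hy : partialTrace₂ (svdPow U U x p) = svdPow V V y 1) {z : ℂ} (hz : z.re = 1) :
    schattenNorm 2 (marginalInterpolant p S T V a y U x z)
      ≤ schattenNorm (2 * p) (svdPow S T a 1) ^ p := by
  have hX : partialTrace₂ (svdPow U U x (p * z / 2) * (svdPow U U x (p * z / 2))ᴴ)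
      = svdPow V V y (z / 2) * (svdPow V V y (z / 2))ᴴ := by
    have hhalf : z / 2 + star (z / 2) = 1 := by
      rw [Complex.star_def, Complex.add_conj]
      simp [hz]
    have hexp : p * z / 2 + star (p * z / 2) = p := by
      rw [mul_div_assoc, star_mul', Complex.star_def, Complex.conj_ofReal, ← mul_add,
        ← Complex.star_def, hhalf, mul_one]
    rw [conjTranspose_svdPow, svdPow_mul_svdPow, conjTranspose_svdPow, svdPow_mul_svdPow, hexp, hy,
      hhalf]
  have hA : schattenNorm 2 (svdPow S T a (p * z)) = schattenNorm (2 * p) (svdPow S T a 1) ^ p := by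
    have hre : (p * z).re = p := by simp [hz]
    rw [schattenNorm_svdPow _ _ _ _ (hre.trans_ne hp.ne'), schattenNorm_svdPow_one, hre, mul_comm p,
      ← Real.rpow_mul (by positivity)]
    congr 1
    field_simp
  calc schattenNorm 2 (marginalInterpolant p S T V a y U x z)
      = schattenNorm 2 (svdPow S T a (p * z) * (svdPow V V y (-z / 2) * svdPow V V y (z / 2))) := by
        rw [marginalInterpolant, schattenNorm_two_amp_mul hX, Matrix.mul_assoc]
    _ ≤ schattenNorm 2 (svdPow S T a (p * z)) * ‖svdPow V V y 0‖ := by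
        rw [svdPow_mul_svdPow, ← add_div, neg_add_cancel, zero_div]
        exact schattenNorm_two_mul_le _ _
    _ ≤ schattenNorm (2 * p) (svdPow S T a 1) ^ p := by
        rw [← hA]
        exact mul_le_of_le_one_right (schattenNorm_nonneg _ _) (norm_svdPow_le_one V V y rfl)

lemma marginalInterpolant_mul_conjTranspose {S' T' : unitaryGroup (Fin m) ℂ} {b : Fin m → ℝ≥0}
    (hp : p ≠ 0) :
    marginalInterpolant p S T V a y U x (1 / p : ℝ)
        * (marginalInterpolant p T' S' V b y U x (star ((1 / p : ℝ) : ℂ)))ᴴ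
      = amp m n (svdPow S T a 1)
        * (amp m n (svdPow V V y (-((2 * p)⁻¹ : ℝ))) * svdPow U U x 1
          * amp m n (svdPow V V y (-((2 * p)⁻¹ : ℝ))))
        * amp m n (svdPow S' T' b 1) := by
  have hp' : (p : ℂ) ≠ 0 := Complex.ofReal_ne_zero.2 hp
  have one_exp : (p : ℂ) * (1 / p : ℝ) = 1 := by
    push_cast
    field_simp
  have half_exp : -((1 / p : ℝ) : ℂ) / 2 = -(2 * p)⁻¹ := by
    push_cast
    field_simp
  have hX : svdPow U U x 1 = svdPow U U x (1 / 2) * svdPow U U x (1 / 2) := by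
    rw [svdPow_mul_svdPow, add_halves]
  rw [conjTranspose_marginalInterpolant_star, marginalInterpolant, one_exp, half_exp, hX, map_mul,
    map_mul]
  simp only [Matrix.mul_assoc]

lemma normInfty_amp_mul_mul_amp_le_one (hp : 1 ≤ p)
    (hy : partialTrace₂ (svdPow U U x p) = svdPow V V y 1) :
    normInfty p (amp m n (svdPow V V y (-((2 * p)⁻¹ : ℝ))) * svdPow U U x 1
      * amp m n (svdPow V V y (-((2 * p)⁻¹ : ℝ)))) ≤ 1 := by
  have hp0 : 0 < p := zero_lt_one.trans_le hp
  refine normInfty_le zero_le_one fun A B => ?_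
  obtain ⟨S, T, a, rfl⟩ := exists_eq_svdPow A
  obtain ⟨S', T', b, rfl⟩ := exists_eq_svdPow B
  set α := schattenNorm (2 * p) (svdPow S T a 1)
  set β := schattenNorm (2 * p) (svdPow T' S' b 1)
  have hα : 0 ≤ α := schattenNorm_nonneg _ _
  have hβ : 0 ≤ β := schattenNorm_nonneg _ _
  have h := schattenNorm_le_rpow_of_stripBounded (C := α ^ p * β ^ p)
    ((stripBounded_marginalInterpolant p S T V a y U x).mul
      (stripBounded_conjTranspose_marginalInterpolant_star p T' S' V b y U x)) hp
    (fun z hz => by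
      refine (norm_mul_le _ _).trans (mul_le_one₀ (norm_marginalInterpolant_le_one hz)
        (norm_nonneg _) ?_)
      rw [l2_opNorm_conjTranspose]
      exact norm_marginalInterpolant_le_one (by simpa using hz))
    fun z hz => by
      refine (schattenNorm_one_mul_le _ _).trans ?_
      rw [schattenNorm_conjTranspose]
      gcongr
      · exact schattenNorm_nonneg _ _
      · exact schattenNorm_two_marginalInterpolant_le hp0 hy hz
      · exact schattenNorm_two_marginalInterpolant_le hp0 hy (by simpa using hz)
  rw [marginalInterpolant_mul_conjTranspose hp0.ne',
    ← Real.mul_rpow hα hβ, one_div, Real.rpow_rpow_inv (mul_nonneg hα hβ) hp0.ne'] at h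
  rw [one_mul, ← schattenNorm_conjTranspose _ (svdPow S' T' b 1), conjTranspose_svdPow, star_one]
  exact h

lemma normLtLp_one_le_sum_rpow (hp : 1 ≤ p)
    (hy : partialTrace₂ (svdPow U U x p) = svdPow V V y 1) :
    normLtLp 1 p (svdPow U U x 1) ≤ ∑ i, (y i : ℝ) ^ p⁻¹ := by
  have hre : (((2 * p)⁻¹ : ℝ) : ℂ).re = (2 * p)⁻¹ := Complex.ofReal_re _
  set Q := svdPow V V y ((2 * p)⁻¹ : ℝ)
  set R := svdPow V V y (-((2 * p)⁻¹ : ℝ))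
  have hQ : schattenNorm (2 * 1) Q = (∑ i, (y i : ℝ) ^ p⁻¹) ^ (1 / 2 : ℝ) := by
    rw [schattenNorm_svdPow _ _ _ _ (hre.trans_ne (by positivity)), hre, mul_one,
      _root_.mul_inv_rev, inv_mul_cancel_right₀ two_ne_zero]
  have hsupp := amp_svdPow_zero_mul_svdPow hy 1
  have hsupp' : svdPow U U x 1 * amp m n (svdPow V V y 0) = svdPow U U x 1 := by
    simpa only [conjTranspose_mul, ← amp_conjTranspose, conjTranspose_svdPow, star_one, star_zero]
      using congr($hsuppᴴ)
  have factorization : svdPow U U x 1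
      = amp m n Q * (amp m n R * svdPow U U x 1 * amp m n R) * amp m n Q := by
    have hQR : amp m n Q * amp m n R = amp m n (svdPow V V y 0) := by
      rw [← map_mul, svdPow_mul_svdPow, add_neg_cancel]
    have hRQ : amp m n R * amp m n Q = amp m n (svdPow V V y 0) := by
      rw [← map_mul, svdPow_mul_svdPow, neg_add_cancel]
    rw [← Matrix.mul_assoc, ← Matrix.mul_assoc, hQR, Matrix.mul_assoc, hRQ, hsupp, hsupp']
  have hnn : 0 ≤ ∑ i, (y i : ℝ) ^ p⁻¹ := by positivity
  calc normLtLp 1 p (svdPow U U x 1)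
      ≤ schattenNorm (2 * 1) Q * schattenNorm (2 * 1) Q
          * normInfty p (amp m n R * svdPow U U x 1 * amp m n R) := normLtLp_le factorization
    _ ≤ schattenNorm (2 * 1) Q * schattenNorm (2 * 1) Q :=
        mul_le_of_le_one_right (mul_self_nonneg _) (normInfty_amp_mul_mul_amp_le_one hp hy)
    _ = ∑ i, (y i : ℝ) ^ p⁻¹ := by
        rw [hQ, ← Real.sqrt_eq_rpow, Real.mul_self_sqrt hnn]

lemma sum_rpow_inv_le_trace {W : unitaryGroup (Fin m) ℂ} {ξ : Fin m → ℝ≥0} (hp : 1 ≤ p)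
    (hy : partialTrace₂ (svdPow U U x p) = svdPow V V y 1)
    (hξ : partialTrace₂ (svdPow U U x 1) = svdPow W W ξ 1) (hξ_sum : ∑ i, (ξ i : ℝ) = 1) :
    (∑ i, (y i : ℝ) ^ p⁻¹) ^ p
      ≤ (amp m n (svdPow W W ξ (1 - p)) * svdPow U U x p).trace.re := by
  obtain ⟨hc, hrow, hcol⟩ := mem_doublyStochastic_iff_sum.1
    (normSq_unitary_mem_doublyStochastic (star W * V))
  simp only [of_apply] at hc hrow hcol
  have hsupp : svdPow W W ξ 0 * svdPow V V y 1 = svdPow V V y 1 := by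
    rw [← hy, ← partialTrace₂_amp_mul, amp_svdPow_zero_mul_svdPow (r := 1) (by simpa using hξ)]
  have suppPow_one_sub (i : Fin m) :
      suppPow (ξ i) (1 - p) = ((ξ i * (ξ i : ℝ)⁻¹ ^ p : ℝ) : ℂ) := by
    by_cases h : ξ i = 0
    · simp [h, suppPow_zero_left]
    · rw [← Complex.ofReal_one, ← Complex.ofReal_sub, suppPow_ofReal h,
        Real.rpow_sub (NNReal.coe_pos.2 (pos_iff_ne_zero.2 h)), Real.rpow_one,
        Real.inv_rpow (ξ i).coe_nonneg, div_eq_mul_inv]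
  have trace_eq : (amp m n (svdPow W W ξ (1 - p)) * svdPow U U x p).trace.re
      = ∑ k : Fin m × Fin m, ‖(star W * V).1 k.1 k.2‖ ^ 2
          * ((ξ k.1 : ℝ) * (ξ k.1 : ℝ)⁻¹ ^ p * (y k.2 : ℝ)) := by
    rw [trace_amp_mul, hy, svdPow_one, svdPow, trace_udv_self_mul_udv_self, Fintype.sum_prod_type]
    simp only [suppPow_one_sub]
    exact_mod_cast rfl
  have sum_eq : ∑ i, (y i : ℝ) ^ p⁻¹
      = ∑ k : Fin m × Fin m, ‖(star W * V).1 k.1 k.2‖ ^ 2 * (y k.2 : ℝ) ^ p⁻¹ := by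
    simp only [Fintype.sum_prod_type_right, ← Finset.sum_mul, hcol, one_mul]
  rw [trace_eq, sum_eq]
  refine sum_mul_rpow_inv_le_of_sum_eq_one hp (fun k => hc _ _) (fun k => (ξ k.1).2)
    (fun k => (y k.2).2) ?_ fun k hk => overlap_mul_eq_zero hsupp (NNReal.coe_eq_zero.1 hk) _
  simp only [Fintype.sum_prod_type, ← Finset.sum_mul, hrow, one_mul, hξ_sum]

lemma normLtLp_one_rpow_le_trace {W : unitaryGroup (Fin m) ℂ} {ξ : Fin m → ℝ≥0} (hp : 1 ≤ p)
    (hξ : partialTrace₂ (svdPow U U x 1) = svdPow W W ξ 1) (hξ_sum : ∑ i, (ξ i : ℝ) = 1) :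
    normLtLp 1 p (svdPow U U x 1) ^ p
      ≤ (amp m n (svdPow W W ξ (1 - p)) * svdPow U U x p).trace.re := by
  have hp0 : 0 < p := zero_lt_one.trans_le hp
  obtain ⟨V, y, hy⟩ : ∃ (V : unitaryGroup (Fin m) ℂ) (y : Fin m → ℝ≥0),
      partialTrace₂ (svdPow U U x p) = svdPow V V y 1 := by
    rw [svdPow_ofReal_eq_svdPow_one U U x hp0.ne']
    exact exists_eq_svdPow_of_posSemidef (posSemidef_partialTrace₂ (posSemidef_svdPow_one _ _))
  exact (Real.rpow_le_rpow (normLtLp_nonneg _ _ _) (normLtLp_one_le_sum_rpow hp hy) hp0.le).trans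
    (sum_rpow_inv_le_trace hp hy hξ hξ_sum)

lemma hasDerivAt_trace_amp_mul {W : unitaryGroup (Fin m) ℂ} {ξ : Fin m → ℝ≥0}
    (hξ : partialTrace₂ (svdPow U U x 1) = svdPow W W ξ 1) :
    HasDerivAt (fun p : ℝ => (amp m n (svdPow W W ξ (1 - p)) * svdPow U U x p).trace.re)
      (-vnEntropy (svdPow U U x 1) + vnEntropy (svdPow W W ξ 1)) 1 := by
  have hsupp : amp m n (svdPow W W ξ 0) * svdPow U U x 1 = svdPow U U x 1 :=
    amp_svdPow_zero_mul_svdPow (r := 1) (by simpa using hξ) 1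
  have hW : HasDerivAt (fun z => svdPow W W ξ (1 - z)) (-(svdLog W ξ * svdPow W W ξ 0)) 1 := by
    have h := (hasDerivAt_svdPow W W ξ (1 - 1)).scomp (1 : ℂ) ((hasDerivAt_id (1 : ℂ)).const_sub 1)
    rw [sub_self, neg_one_smul] at h
    exact h
  have h := hasDerivAt_trace ((hasDerivAt_amp hW).mul (hasDerivAt_svdPow U U x 1))
  have value : (amp m n (-(svdLog W ξ * svdPow W W ξ 0)) * svdPow U U x 1
      + amp m n (svdPow W W ξ (1 - 1)) * (svdLog U x * svdPow U U x 1)).trace.re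
      = -vnEntropy (svdPow U U x 1) + vnEntropy (svdPow W W ξ 1) := by
    rw [trace_add, sub_self, ← svdPow_mul_svdLog U U, ← Matrix.mul_assoc, hsupp, svdPow_mul_svdLog,
      map_neg, map_mul, Matrix.neg_mul, Matrix.mul_assoc, hsupp, trace_neg, trace_amp_mul, hξ,
      Complex.add_re, Complex.neg_re, trace_svdLog_mul_svdPow_one, trace_svdLog_mul_svdPow_one]
    ring
  rw [← value]
  exact HasDerivAt.real_of_complex (z := 1) (by rw [Complex.ofReal_one]; exact h)

end UpperBound

end OperatorSpaceEntropy

end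

open OperatorSpaceEntropy in
theorem mainTheorem9 (m n : ℕ) (X : Matrix (Fin m × Fin n) (Fin m × Fin n) ℂ)
    (hX : X.PosSemidef) (htr : X.trace = 1) :
    HasDerivWithinAt
      (fun p : ℝ => OperatorSpaceEntropy.normLtLp 1 p X ^ p)
      (-OperatorSpaceEntropy.vnEntropy X
        + OperatorSpaceEntropy.vnEntropy (OperatorSpaceEntropy.partialTrace₂ X))
      (Set.Ici 1) 1 := by
  have h_lower : HasDerivAt
      (fun p : ℝ => Real.exp ((p - 1) * (-vnEntropy X + vnEntropy (partialTrace₂ X))))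
      (-vnEntropy X + vnEntropy (partialTrace₂ X)) 1 := by
    simpa using (((hasDerivAt_id (1 : ℝ)).sub_const 1).mul_const
      (-vnEntropy X + vnEntropy (partialTrace₂ X))).exp
  have lower_le := fun p (hp : 1 ≤ p) => exp_le_normLtLp_one_rpow hX htr hp
  obtain ⟨W, ξ, hξ⟩ := exists_eq_svdPow_of_posSemidef (posSemidef_partialTrace₂ hX)
  have hξ_sum : ∑ i, (ξ i : ℝ) = 1 := by
    have h := trace_partialTrace₂ X
    rw [hξ, svdPow_one, trace_udv_self, htr] at h
    exact_mod_cast h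
  obtain ⟨U, x, rfl⟩ := exists_eq_svdPow_of_posSemidef hX
  have h_upper := hasDerivAt_trace_amp_mul hξ
  rw [← hξ] at h_upper
  refine hasDerivWithinAt_Ici_of_squeeze h_lower h_upper ?_ lower_le
    fun p hp => normLtLp_one_rpow_le_trace hp hξ hξ_sum
  rw [Complex.ofReal_one, sub_self, sub_self,
    amp_svdPow_zero_mul_svdPow (r := 1) (by simpa using hξ), htr, zero_mul, Real.exp_zero,
    Complex.one_re]
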